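/- Let $p>1$. Consider the renewal Markov chain on $\mathbb{N}=\{0,1,2,\dots\}$ with transition kernel $K$ that jumps from $0$ to $n>0$ with probability $1/(\zeta(p+1)\,n^{p+1})$ and from $n>0$ to $n-1$ with probability $1$. It has the invariant probability measure $\pi$ given by $\pi\{n\}=\sum_{i\ge n} d/i^{p+1}$ for $n>0$ and $\pi\{0\}=\pi\{1\}$, where $d>0$ is chosen so that $\pi$ has mass $1$. Write $Kg(m)=\sum_{k}K(m,\{k\})\,g(k)$, $\pi(g)=\int g\,d\pi$ and $\|g\|_\infty=\sup_m|g(m)|$ for bounded $g:\mathbb{N}\to\mathbb{R}$. (a) The chain satisfies condition $\mathbf{H}(p)$ for the sup norm: there are constants $C_1,C_2>0$ such that, for every bounded $g:\mathbb{N}\to\mathbb{R}$, $$\pi\big(|K^n g-\pi(g)|\big)\le \frac{C_1\|g\|_\infty}{n^{p-1}}\quad (n\ge 1),\qquad\text{and}\qquad K^n g\ \text{is bounded with}\ \|K^n g\|_\infty\le C_2\|g\|_\infty\quad (n\ge 0).$$ (b) Let $f(n)=\pi\{0\}-\mathbf{1}_{n=0}$. Then $\pi(f)=0$, and there exists $\kappa>0$,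 depending only on $p$, such that for every stationary Markov chain $(Y_i)_{i\in\mathbb{N}}$ with transition kernel $K$ and $Y_0$ distributed according to $\pi$, every integer $n\ge 1$ and every $x\in[\kappa n^{1/p},\kappa^{-1}n]$, $$\mathbb{P}\Big(\sum_{i=0}^{n-1} f(Y_i)\ge x\Big)\ \ge\ \kappa^{-1}\frac{n}{x^p}.$$ -/

import Mathlib

open MeasureTheory ProbabilityTheory

/-! ### Polynomial convergence to equilibrium -/

section Mixing

variable {X : Type*} [MeasurableSpace X]

/-- The transition operator of a kernel, `(K f)(x) = ∫ f(y) K(x, dy)`. Its `n`-th iterate is the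
`K ^ n` of the conditions below. -/
noncomputable def transitionOp (K : Kernel X X) (f : X → ℝ) : X → ℝ :=
  fun x => ∫ y, f y ∂(K x)

/-- Condition `H₁(p)` for a norm `N` on a vector space `B` of functions (only the values of `N` on
`B` matter): `π(|K^n f - π(f)|) ≤ C₁ N(f) / n^(p-1)` for all `f ∈ B` and `n ≥ 1`. -/
def ConditionH1 (K : Kernel X X) (π : Measure X) (B : Submodule ℝ (X → ℝ)) (N : (X → ℝ) → ℝ)
    (p : ℝ) : Prop :=
  ∃ C₁ : ℝ, 0 < C₁ ∧ ∀ f ∈ B, ∀ n : ℕ, 1 ≤ n →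
    ∫ x, |(transitionOp K)^[n] f x - ∫ y, f y ∂π| ∂π ≤ C₁ * N f / (n : ℝ) ^ (p - 1)

/-- Condition `H₂`: the space `B` is invariant under `K`, and `N(K^n f) ≤ C₂ N(f)`. -/
def ConditionH2 (K : Kernel X X) (B : Submodule ℝ (X → ℝ)) (N : (X → ℝ) → ℝ) : Prop :=
  ∃ C₂ : ℝ, 0 < C₂ ∧ ∀ f ∈ B, ∀ n : ℕ,
    (transitionOp K)^[n] f ∈ B ∧ N ((transitionOp K)^[n] f) ≤ C₂ * N f

/-- Condition `H(p)`: the chain converges polynomially to equilibrium, with exponent `p`, for the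
norm `N` on `B`. -/
def ConditionH (K : Kernel X X) (π : Measure X) (B : Submodule ℝ (X → ℝ)) (N : (X → ℝ) → ℝ)
    (p : ℝ) : Prop :=
  ConditionH1 K π B N p ∧ ConditionH2 K B N

/-- The space of bounded measurable functions. -/
def boundedFunctions (X : Type*) [MeasurableSpace X] : Submodule ℝ (X → ℝ) where
  carrier := {f | Measurable f ∧ ∃ C : ℝ, ∀ x, |f x| ≤ C}
  zero_mem' := ⟨measurable_const, 0, fun x => by simp⟩
  add_mem' := by
    rintro f g ⟨hf, C, hC⟩ ⟨hg, D, hD⟩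
    exact ⟨hf.add hg, C + D, fun x => (abs_add_le _ _).trans (add_le_add (hC x) (hD x))⟩
  smul_mem' := by
    rintro c f ⟨hf, C, hC⟩
    refine ⟨hf.const_smul c, |c| * C, fun x => ?_⟩
    rw [Pi.smul_apply, smul_eq_mul, abs_mul]
    exact mul_le_mul_of_nonneg_left (hC x) (abs_nonneg c)

/-- The supremum norm of a bounded function. -/
noncomputable def supNorm {X : Type*} (f : X → ℝ) : ℝ := ⨆ x, |f x|

end Mixing

/-! ### Markov chains on a countable discrete state space -/

/-- `(Y_i)` is a Markov chain with transition kernel `K` and initial law `ν` on the countable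
state space `X`:
`P(Y_0 = a_0, …, Y_n = a_n) = ν{a_0} K(a_0, {a_1}) ⋯ K(a_{n-1}, {a_n})`.
It is a stationary chain when `ν` is invariant under `K`. -/
structure IsMarkovChain {X Ω : Type*} [Countable X] [MeasurableSpace X]
    [MeasurableSingletonClass X] [MeasurableSpace Ω]
    (K : Kernel X X) (ν : Measure X) (P : Measure Ω) (Y : ℕ → Ω → X) : Prop where
  measurable : ∀ i, Measurable (Y i)
  cylinder : ∀ (n : ℕ) (a : ℕ → X),
    P {ω | ∀ i ≤ n, Y i ω = a i} = ν {a 0} * ∏ i ∈ Finset.range n, K (a i) {a (i + 1)}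

/-! ### The renewal chain -/

/-- `ζ(s)` for real `s > 1`. -/
noncomputable def realZeta (s : ℝ) : ℝ := ∑' k : ℕ, 1 / ((k : ℝ) + 1) ^ s

theorem ofReal_realZeta {s : ℝ} (hs : 1 < s) : (realZeta s : ℂ) = riemannZeta (s : ℂ) := by
  rw [zeta_eq_tsum_one_div_nat_add_one_cpow (by simpa using hs), realZeta, Complex.ofReal_tsum]
  refine tsum_congr fun k => ?_
  have hk : (0 : ℝ) ≤ (k : ℝ) + 1 := by positivity
  rw [Complex.ofReal_div, Complex.ofReal_cpow hk]
  push_cast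
  rfl

/-- Transition probabilities of the renewal chain: from `0` to `n > 0` with probability
`1 / (ζ(p+1) n^(p+1))`, and from `n > 0` to `n - 1` with probability `1`. -/
noncomputable def renewalProb (p : ℝ) : ℕ → ℕ → ℝ
  | 0, n => if n = 0 then 0 else 1 / (realZeta (p + 1) * (n : ℝ) ^ (p + 1))
  | m + 1, n => if n = m then 1 else 0

/-- The transition kernel of the renewal chain. -/
noncomputable def renewalKernel (p : ℝ) : Kernel ℕ ℕ where
  toFun m := Measure.sum fun n => ENNReal.ofReal (renewalProb p m n) • Measure.dirac n
  measurable' := measurable_of_countable _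

/-- The unnormalized invariant weights: `∑_{i ≥ n} 1 / i^(p+1)` for `n > 0`, and the weight of `0`
is that of `1`. -/
noncomputable def renewalWeight (p : ℝ) (n : ℕ) : ℝ :=
  ∑' j : ℕ, 1 / ((max n 1 + j : ℕ) : ℝ) ^ (p + 1)

/-- The measure `π` with `π{n} = ∑_{i ≥ n} d / i^(p+1)` for `n > 0` and `π{0} = π{1}`, where `d` is
the inverse of the total weight, so that `π` has mass `1`. -/
noncomputable def renewalMeasure (p : ℝ) : Measure ℕ :=
  Measure.sum fun n =>
    ENNReal.ofReal ((∑' k, renewalWeight p k)⁻¹ * renewalWeight p n) • Measure.dirac n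

/-- The observable `f(n) = π{0} - 1_{n = 0}`. -/
noncomputable def renewalObservable (p : ℝ) (n : ℕ) : ℝ :=
  (renewalMeasure p).real {0} - if n = 0 then 1 else 0

/-! Let `q` be the law of the jump from 0, `T` its tail (`renewalTail`) and `μ` the sum of `T`, so
that `π{n} = T n / μ`.

For (a), take `g` centred and put `h n = K ^ n g (0)`. Away from 0 the chain moves
deterministically, so `K ^ n g (m)` is `h (n - m)` for `m ≤ n` and `g (m - n)` otherwise.
Invariance, `π(K ^ n g) = 0`, thus becomes a convolution equation `T * h = ρ`, where `ρ` is a tail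
of `∑ T` weighted by `g` and is `O(n ^ (1 - p))` (`sum_renewalTail_mul_transitionOp`). Formally `(1
- z) T(z) = 1 - ∑ q k z ^ (k + 1)`. A zero of `T` in the closed disc would force `z ^ k = 1` for all
`k ≥ 2`, hence `z = 1`; but `T(1) = μ > 0` (`tsum_renewalTail_mul_pow_ne_zero`). By Wiener's lemma
`1 / T` has summable coefficients, and a weighted sup-norm estimate transfers the decay of `ρ` to
`h` (`exists_decay_of_conv_eq`). Integrating against `π`, split near `m = n / 2`, gives the mixing
rate.

For (b), `π{0} = 1 / μ`, so the Birkhoff sum is `n / μ` minus the number of visits to 0. At most `L`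
visits occur before time `n` exactly when the first hitting time of 0 plus `L` excursion lengths is
at least `n`; starting from 0 is the worst case (`excursionProb_le_measure_visits_le`). With `L`
close to `n / μ - x`, one excursion of length of order `x` suffices if the others do not fall more
than `2 x` below their mean. There are of order `n` candidates for the long excursion, each of
probability of order `x ^ (-p)`; the remaining excursions, truncated at level about `x`, behave with
probability bounded below by a fourth-moment argument (`le_measureReal_sum_pi_of_jump`). -/

/-! ### A Wiener lemma for power series -/

/-- Functional calculus by absolutely convergent power series: if `∑ T n z ^ n` has no zero in the
closed unit disc, then `∑ T n • S ^ n` is invertible for every contraction `S` of a complex Banach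
algebra. -/
theorem isUnit_tsum_smul_pow {R : Type*} [NormedRing R] [NormedAlgebra ℂ R] [CompleteSpace R]
    [NormOneClass R] {S : R} (hS : ‖S‖ ≤ 1) {T : ℕ → ℂ} (hT : Summable fun n => ‖T n‖)
    (h0 : ∀ z : ℂ, ‖z‖ ≤ 1 → ∑' n, T n * z ^ n ≠ 0) : IsUnit (∑' n, T n • S ^ n) := by
  -- Gelfand theory needs commutativity, so the argument runs in the closed subalgebra generated by
  -- `S`. There a non-unit is killed by some character `φ`, and `φ s` lies in the closed disc, where
  -- the series does not vanish.
  let A := Algebra.elemental ℂ S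
  let _ : NormedCommRing A := { (inferInstance : NormedRing A) with mul_comm := mul_comm }
  let s : A := ⟨S, Algebra.elemental.self_mem ℂ S⟩
  have hs1 : ‖s‖ ≤ 1 := hS
  have hone : ‖(1 : A)‖ ≤ 1 := (norm_one (α := R)).le
  have hpow : ∀ n : ℕ, ‖s ^ n‖ ≤ 1 := by
    intro n
    induction n with
    | zero => simpa using hone
    | succ n ih =>
      rw [pow_succ]
      exact (norm_mul_le _ _).trans (mul_le_one₀ ih (norm_nonneg _) hs1)
  have hsum : Summable fun n => T n • s ^ n := by
    refine Summable.of_norm_bounded hT fun n => ?_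
    refine (norm_smul_le _ _).trans ?_
    exact mul_le_of_le_one_right (norm_nonneg _) (hpow n)
  have hu : IsUnit (∑' n, T n • s ^ n) := by
    by_contra hn
    obtain ⟨φ, hφ⟩ := WeakDual.CharacterSpace.exists_apply_eq_zero hn
    have hnorm : ‖φ s‖ ≤ 1 :=
      (AlgHom.norm_apply_le_self_mul_norm_one φ s).trans
        (mul_le_one₀ hs1 (norm_nonneg _) hone)
    refine h0 (φ s) hnorm ?_
    rw [← hφ, Summable.map_tsum hsum φ (map_continuous φ)]
    exact tsum_congr fun n => by rw [map_smul, map_pow, smul_eq_mul]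
  have hmap : A.val (∑' n, T n • s ^ n) = ∑' n, T n • S ^ n := by
    rw [Summable.map_tsum hsum A.val continuous_subtype_val]
    exact tsum_congr fun n => by rw [map_smul, map_pow]; rfl
  rw [← hmap]
  exact hu.map A.val

/-- The right shift on sequences. -/
def rightShift (f : ℕ → ℂ) (n : ℕ) : ℂ := if n = 0 then 0 else f (n - 1)

theorem memℓp_one_iff {f : ℕ → ℂ} : Memℓp f 1 ↔ Summable fun n => ‖f n‖ := by
  rw [memℓp_gen_iff (by simp)]
  simp

theorem lp_one_norm_eq (f : lp (fun _ : ℕ => ℂ) 1) : ‖f‖ = ∑' n, ‖f n‖ := by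
  rw [lp.norm_eq_tsum_rpow (by simp)]
  simp

theorem lp_one_summable (f : lp (fun _ : ℕ => ℂ) 1) : Summable fun n => ‖f n‖ :=
  memℓp_one_iff.1 (lp.memℓp f)

theorem summable_norm_rightShift {f : ℕ → ℂ} (hf : Summable fun n => ‖f n‖) :
    Summable fun n => ‖rightShift f n‖ := by
  rw [← summable_nat_add_iff 1]
  simpa [rightShift] using hf

/-- The right shift as a linear map on `ℓ¹`. -/
def lpRightShiftLinear : lp (fun _ : ℕ => ℂ) 1 →ₗ[ℂ] lp (fun _ : ℕ => ℂ) 1 where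
  toFun f := ⟨rightShift f, memℓp_one_iff.2 (summable_norm_rightShift (lp_one_summable f))⟩
  map_add' f g := by
    ext n
    change (if n = 0 then 0 else f (n - 1) + g (n - 1)) =
      (if n = 0 then 0 else f (n - 1)) + (if n = 0 then 0 else g (n - 1))
    split_ifs <;> simp
  map_smul' c f := by
    ext n
    by_cases h : n = 0 <;> simp [rightShift, h]

theorem norm_lpRightShiftLinear_le (f : lp (fun _ : ℕ => ℂ) 1) :
    ‖lpRightShiftLinear f‖ ≤ 1 * ‖f‖ := by
  rw [one_mul, lp_one_norm_eq, lp_one_norm_eq, (lp_one_summable _).tsum_eq_zero_add]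
  simp [lpRightShiftLinear, rightShift]

/-- The right shift as a bounded operator on `ℓ¹`. -/
noncomputable def lpRightShift : lp (fun _ : ℕ => ℂ) 1 →L[ℂ] lp (fun _ : ℕ => ℂ) 1 :=
  lpRightShiftLinear.mkContinuous 1 norm_lpRightShiftLinear_le

theorem norm_lpRightShift_le : ‖lpRightShift‖ ≤ 1 :=
  LinearMap.mkContinuous_norm_le _ zero_le_one _

theorem lpRightShift_apply (f : lp (fun _ : ℕ => ℂ) 1) (n : ℕ) :
    lpRightShift f n = if n = 0 then 0 else f (n - 1) := rfl

theorem lpRightShift_pow_apply (f : lp (fun _ : ℕ => ℂ) 1) (k n : ℕ) :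
    (lpRightShift ^ k) f n = if n < k then 0 else f (n - k) := by
  induction k generalizing n with
  | zero => simp
  | succ k ih =>
    rw [pow_succ', mul_apply_eq_comp, lpRightShift_apply, ih]
    rcases n with _ | n
    · simp
    · simp

/-- Substituting the right shift of `ℓ¹` into the series gives convolution by `T`. The inverse
operator applied to the unit vector `e` is an `ℓ¹` sequence whose convolution with `T` is `e`. -/
theorem exists_summable_powerSeries_inverse_complex {T : ℕ → ℂ} (hT : Summable fun n => ‖T n‖)
    (h0 : ∀ z : ℂ, ‖z‖ ≤ 1 → ∑' n, T n * z ^ n ≠ 0) :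
    ∃ b : ℕ → ℂ, (Summable fun n => ‖b n‖) ∧ PowerSeries.mk T * PowerSeries.mk b = 1 := by
  let E := lp (fun _ : ℕ => ℂ) 1
  let e : E := lp.single 1 0 1
  -- Needed for the identity operator to have norm one.
  have : Nontrivial E := ⟨e, 0, fun h => by
    have := congrArg (fun f : E => f 0) h
    simp [e] at this⟩
  have hpow : ∀ n : ℕ, ‖lpRightShift ^ n‖ ≤ 1 := fun n =>
    (norm_pow_le lpRightShift n).trans (pow_le_one₀ (norm_nonneg _) norm_lpRightShift_le)
  have hsum : Summable fun n => T n • lpRightShift ^ n := by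
    refine Summable.of_norm_bounded hT fun n => ?_
    refine (norm_smul_le (T n) (lpRightShift ^ n)).trans ?_
    exact mul_le_of_le_one_right (norm_nonneg _) (hpow n)
  obtain ⟨B, hB⟩ := (isUnit_tsum_smul_pow norm_lpRightShift_le hT h0).exists_right_inv
  let b : E := B e
  refine ⟨b, lp_one_summable b, ?_⟩
  ext n
  have hcoord : Continuous fun f : E => f n := by
    have : LipschitzWith 1 fun f : E => f n := LipschitzWith.of_dist_le_mul fun f g => by
      rw [dist_eq_norm, dist_eq_norm, NNReal.coe_one, one_mul]
      exact lp.norm_apply_le_norm one_ne_zero (f - g) n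
    exact this.continuous
  let ev : (E →L[ℂ] E) →+ ℂ :=
    { toFun := fun U => U b n, map_zero' := by simp, map_add' := fun U V => by simp }
  have hev : Continuous ev :=
    hcoord.comp (ContinuousLinearMap.apply ℂ E b).continuous
  have h1 : ev (∑' k, T k • lpRightShift ^ k) = e n := by
    change ((∑' k, T k • lpRightShift ^ k) * B) e n = e n
    rw [hB]; rfl
  rw [Summable.map_tsum hsum ev hev] at h1
  rw [PowerSeries.coeff_mul, Finset.Nat.sum_antidiagonal_eq_sum_range_succ
    (fun i j => PowerSeries.coeff i (PowerSeries.mk T) * PowerSeries.coeff j (PowerSeries.mk b)),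
    PowerSeries.coeff_one]
  have h2 : e n = if n = 0 then 1 else 0 := by
    by_cases h : n = 0
    · subst h; simp [e]
    · simp [e, h]
  rw [← h2, ← h1, tsum_eq_sum (s := Finset.range n.succ)]
  · refine Finset.sum_congr rfl fun k hk => ?_
    have : ¬ n < k := by simpa [Nat.lt_succ_iff] using hk
    change _ = T k * (lpRightShift ^ k) b n
    rw [lpRightShift_pow_apply, if_neg this, PowerSeries.coeff_mk, PowerSeries.coeff_mk]
  · intro k hk
    have : n < k := by simpa using hk
    change T k * (lpRightShift ^ k) b n = 0
    rw [lpRightShift_pow_apply, if_pos this, mul_zero]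

/-- **Wiener's lemma** for one-sided real sequences. -/
theorem exists_summable_powerSeries_inverse {T : ℕ → ℝ} (hT : Summable fun n => |T n|)
    (h0 : ∀ z : ℂ, ‖z‖ ≤ 1 → ∑' n, (T n : ℂ) * z ^ n ≠ 0) :
    ∃ b : ℕ → ℝ, (Summable fun n => |b n|) ∧ PowerSeries.mk T * PowerSeries.mk b = 1 := by
  obtain ⟨b, hb, hTb⟩ := exists_summable_powerSeries_inverse_complex
    (T := fun n => (T n : ℂ)) (by simpa using hT) h0
  -- As `T` is real, taking real parts commutes with convolution by `T`.
  refine ⟨fun n => (b n).re, Summable.of_nonneg_of_le (fun _ => abs_nonneg _)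
    (fun n => Complex.abs_re_le_norm _) hb, ?_⟩
  ext n
  have := congrArg (fun φ => (PowerSeries.coeff n φ).re) hTb
  simp only [PowerSeries.coeff_mul, PowerSeries.coeff_mk, PowerSeries.coeff_one, Complex.re_sum,
    Complex.re_ofReal_mul] at this ⊢
  rw [this]
  split_ifs <;> simp

/-! ### Convolution equations with a summable inverse -/

/-- Young's inequality for `ℓ¹ * ℓ^∞`. -/
theorem abs_conv_le {a c : ℕ → ℝ} {s M : ℝ} (ha : ∀ n, ∑ k ∈ Finset.range n, |a k| ≤ s)
    (hc : ∀ n, |c n| ≤ M) (n : ℕ) :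
    |∑ k ∈ Finset.range (n + 1), a k * c (n - k)| ≤ s * M := by
  have hM : 0 ≤ M := (abs_nonneg _).trans (hc 0)
  calc |∑ k ∈ Finset.range (n + 1), a k * c (n - k)|
      ≤ ∑ k ∈ Finset.range (n + 1), |a k * c (n - k)| := Finset.abs_sum_le_sum_abs _ _
    _ ≤ ∑ k ∈ Finset.range (n + 1), |a k| * M := Finset.sum_le_sum fun k _ => by
        rw [abs_mul]; exact mul_le_mul_of_nonneg_left (hc _) (abs_nonneg _)
    _ = (∑ k ∈ Finset.range (n + 1), |a k|) * M := by rw [Finset.sum_mul]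
    _ ≤ s * M := mul_le_mul_of_nonneg_right (ha _) hM

theorem eq_conv_of_conv_eq {T b h ρ : ℕ → ℝ} (hTb : PowerSeries.mk T * PowerSeries.mk b = 1)
    (hρ : ∀ n, ∑ k ∈ Finset.range (n + 1), T k * h (n - k) = ρ n) (n : ℕ) :
    h n = ∑ k ∈ Finset.range (n + 1), b k * ρ (n - k) := by
  have h1 : PowerSeries.mk T * PowerSeries.mk h = PowerSeries.mk ρ := by
    ext m
    rw [PowerSeries.coeff_mul, Finset.Nat.sum_antidiagonal_eq_sum_range_succ
      (fun i j => PowerSeries.coeff i (PowerSeries.mk T) * PowerSeries.coeff j (PowerSeries.mk h))]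
    simpa using hρ m
  have h2 : PowerSeries.mk h = PowerSeries.mk b * PowerSeries.mk ρ := by
    rw [← h1, ← mul_assoc, mul_comm (PowerSeries.mk b), hTb, one_mul]
  have h3 := congrArg (PowerSeries.coeff n) h2
  rw [PowerSeries.coeff_mul, Finset.Nat.sum_antidiagonal_eq_sum_range_succ
      (fun i j => PowerSeries.coeff i (PowerSeries.mk b) * PowerSeries.coeff j (PowerSeries.mk ρ))]
    at h3
  simpa using h3

/-- If `1 / T` has summable coefficients and `T n = O(n ^ (-(r + 1)))`, then a bounded solution `h`
of `T * h = ρ` with `ρ n = O(n ^ (-r))` is `O(n ^ (-r))` as well. -/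
theorem exists_decay_of_conv_eq {T b : ℕ → ℝ} {r C : ℝ} (hr : 0 < r) (hT0 : ∀ n, 0 ≤ T n)
    (hT : Summable T) (hTC : ∀ n : ℕ, T n ≤ C / ((n : ℝ) + 1) ^ (r + 1))
    (hb : Summable fun n => |b n|) (hTb : PowerSeries.mk T * PowerSeries.mk b = 1) :
    ∃ D : ℝ, 0 ≤ D ∧ ∀ (h ρ : ℕ → ℝ) (H : ℝ),
      (∀ n, ∑ k ∈ Finset.range (n + 1), T k * h (n - k) = ρ n) → (∀ n, |h n| ≤ H) →
      (∀ n : ℕ, |ρ n| ≤ H / ((n : ℝ) + 1) ^ r) → ∀ n : ℕ, |h n| ≤ D * H / ((n : ℝ) + 1) ^ r := by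
  have hC : 0 ≤ C := by simpa using (hT0 0).trans (hTC 0)
  set β : ℝ := ∑' n, |b n| with hβ
  set τ : ℝ := ∑' n, T n with hτ
  have hβ0 : 0 ≤ β := tsum_nonneg fun _ => abs_nonneg _
  have hτ0 : 0 ≤ τ := tsum_nonneg hT0
  have hbs : ∀ n, ∑ k ∈ Finset.range n, |b k| ≤ β := fun n =>
    hb.sum_le_tsum _ fun _ _ => abs_nonneg _
  have hTs : ∀ n, ∑ k ∈ Finset.range n, T k ≤ τ := fun n => hT.sum_le_tsum _ fun _ _ => hT0 _
  -- Small enough that the commutator term, after inversion by `b`, is at most half of the weighted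
  -- supremum and can be absorbed.
  set ε : ℝ := 1 / (2 * (β * τ + 1)) with hε
  have hε0 : 0 < ε := by positivity
  have hεβ : β * (ε * τ) ≤ 1 / 2 := by
    have : β * τ / (β * τ + 1) ≤ 1 := by
      rw [div_le_one (by positivity)]; linarith
    calc β * (ε * τ) = (β * τ / (β * τ + 1)) / 2 := by rw [hε]; field_simp
      _ ≤ 1 / 2 := by linarith
  obtain ⟨δ, hδ0, hδ1, hδ⟩ : ∃ δ : ℝ, 0 < δ ∧ δ < 1 ∧ 1 ≤ (1 + ε) * (1 - δ) ^ r := by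
    have hcont : ContinuousAt (fun d : ℝ => (1 + ε) * (1 - d) ^ r) 0 := by
      refine ContinuousAt.mul continuousAt_const (ContinuousAt.rpow_const (by fun_prop) ?_)
      left; norm_num
    have hev := hcont.eventually (lt_mem_nhds (a := (1 : ℝ)) (by simp; linarith))
    obtain ⟨η, hη, hball⟩ := Metric.eventually_nhds_iff.1 hev
    refine ⟨min (η / 2) (1 / 2), by positivity, by
      have := min_le_right (η / 2) (1 / 2 : ℝ); linarith, (hball ?_).le⟩
    rw [Real.dist_eq, sub_zero, abs_of_pos (by positivity)]
    have := min_le_left (η / 2) (1 / 2 : ℝ); linarith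
  set G : ℝ := C / δ ^ (r + 1) with hG
  have hG0 : 0 ≤ G := by positivity
  refine ⟨2 * (β * (1 + G)), by positivity, fun h ρ H hconv hh hρ => ?_⟩
  have hH : 0 ≤ H := (abs_nonneg _).trans (hh 0)
  -- Capping the weight at `N` makes the weighted supremum `M` finite a priori, which absorption
  -- requires. The resulting bound does not depend on `N`.
  have key : ∀ N : ℝ, 0 < N → ∀ n : ℕ, min (((n : ℝ) + 1) ^ r) N * |h n| ≤ 2 * (β * (1 + G)) * H := by
    intro N hN
    set φ : ℕ → ℝ := fun n => ((n : ℝ) + 1) ^ r with hφ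
    set w : ℕ → ℝ := fun n => min (φ n) N with hw
    have hφ0 : ∀ n, 0 < φ n := fun n => by simp only [hφ]; positivity
    have hw0 : ∀ n, 0 < w n := fun n => lt_min (hφ0 n) hN
    have hφm : Monotone φ := fun m n hmn => by
      simp only [hφ]
      exact Real.rpow_le_rpow (by positivity) (by gcongr) hr.le
    have hwm : Monotone w := fun m n hmn => min_le_min_right _ (hφm hmn)
    set f : ℕ → ℝ := fun n => w n * |h n| with hf
    have hbdd : BddAbove (Set.range f) := ⟨N * H, by
      rintro _ ⟨n, rfl⟩
      exact mul_le_mul (min_le_right _ _) (hh n) (abs_nonneg _) hN.le⟩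
    set M : ℝ := ⨆ n, f n with hM
    have hfM : ∀ n, f n ≤ M := le_ciSup hbdd
    have hM0 : 0 ≤ M := (mul_nonneg (hw0 0).le (abs_nonneg _)).trans (hfM 0)
    -- Commutator of the weight with convolution by `T`. For `k ≤ δ (n + 1)` the weight varies by a
    -- factor at most `1 + ε`; for larger `k` the decay of `T k` compensates the full weight and
    -- leaves `G * H / (n + 1)`, which sums over `n + 1` terms to `G * H`.
    have hterm : ∀ n k : ℕ, k ≤ n →
        T k * ((w n - w (n - k)) * |h (n - k)|) ≤ T k * (ε * M) + G * H / ((n : ℝ) + 1) := by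
      intro n k hk
      have hn1 : (0 : ℝ) < (n : ℝ) + 1 := by positivity
      have hwd : 0 ≤ w n - w (n - k) := sub_nonneg.2 (hwm (Nat.sub_le n k))
      rcases le_or_gt ((k : ℝ)) (δ * ((n : ℝ) + 1)) with hkδ | hkδ
      · have h1 : φ n ≤ (1 + ε) * φ (n - k) := by
          simp only [hφ]
          rw [Nat.cast_sub hk]
          have h2 : (1 - δ) * ((n : ℝ) + 1) ≤ (n : ℝ) - k + 1 := by linarith
          calc ((n : ℝ) + 1) ^ r = 1 * ((n : ℝ) + 1) ^ r := (one_mul _).symm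
            _ ≤ ((1 + ε) * (1 - δ) ^ r) * ((n : ℝ) + 1) ^ r := by gcongr
            _ = (1 + ε) * ((1 - δ) * ((n : ℝ) + 1)) ^ r := by
              rw [Real.mul_rpow (by linarith) hn1.le]; ring
            _ ≤ (1 + ε) * ((n : ℝ) - k + 1) ^ r := by
              gcongr
        have h2 : w n ≤ (1 + ε) * w (n - k) := by
          simp only [hw]
          rw [mul_min_of_nonneg _ _ (by positivity)]
          exact min_le_min h1 (by nlinarith)
        have h3 : (w n - w (n - k)) * |h (n - k)| ≤ ε * M := by
          calc (w n - w (n - k)) * |h (n - k)| ≤ (ε * w (n - k)) * |h (n - k)| := by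
                gcongr; linarith
            _ = ε * f (n - k) := by simp only [hf]; ring
            _ ≤ ε * M := by gcongr; exact hfM _
        have h4 : T k * ((w n - w (n - k)) * |h (n - k)|) ≤ T k * (ε * M) :=
          mul_le_mul_of_nonneg_left h3 (hT0 k)
        have h5 : 0 ≤ G * H / ((n : ℝ) + 1) := by positivity
        linarith
      · have h1 : (w n - w (n - k)) * |h (n - k)| ≤ φ n * H := by
          have : w n - w (n - k) ≤ φ n := by
            have := min_le_left (φ n) N
            have := (hw0 (n - k)).le
            simp only [hw] at *
            linarith
          exact mul_le_mul this (hh _) (abs_nonneg _) (hφ0 n).le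
        have h2 : T k ≤ C / (δ * ((n : ℝ) + 1)) ^ (r + 1) := by
          refine (hTC k).trans ?_
          gcongr
          linarith
        have h3 : C / (δ * ((n : ℝ) + 1)) ^ (r + 1) * (φ n * H) = G * H / ((n : ℝ) + 1) := by
          simp only [hφ, hG]
          rw [Real.mul_rpow hδ0.le hn1.le, Real.rpow_add_one hn1.ne']
          have := (Real.rpow_pos_of_pos hn1 r).ne'
          have := (Real.rpow_pos_of_pos hδ0 (r + 1)).ne'
          field_simp
        have h4 : T k * ((w n - w (n - k)) * |h (n - k)|) ≤ G * H / ((n : ℝ) + 1) := by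
          rw [← h3]
          exact mul_le_mul h2 h1 (mul_nonneg hwd (abs_nonneg _)) (by positivity)
        have h5 : 0 ≤ T k * (ε * M) := mul_nonneg (hT0 k) (by positivity)
        linarith
    set σ : ℕ → ℝ := fun n => ∑ k ∈ Finset.range (n + 1), T k * (w (n - k) * h (n - k)) with hσ
    have hσb : ∀ n, |σ n| ≤ H + (ε * τ * M + G * H) := by
      intro n
      have hn1 : (0 : ℝ) < (n : ℝ) + 1 := by positivity
      have h1 : σ n = w n * ρ n -
          ∑ k ∈ Finset.range (n + 1), T k * ((w n - w (n - k)) * h (n - k)) := by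
        rw [← hconv n, Finset.mul_sum, ← Finset.sum_sub_distrib]
        exact Finset.sum_congr rfl fun k _ => by ring
      have h2 : |w n * ρ n| ≤ H := by
        rw [abs_mul, abs_of_pos (hw0 n)]
        calc w n * |ρ n| ≤ φ n * (H / φ n) :=
              mul_le_mul (min_le_left _ _) (hρ n) (abs_nonneg _) (hφ0 n).le
          _ = H := by field_simp [(hφ0 n).ne']
      have h3 : |∑ k ∈ Finset.range (n + 1), T k * ((w n - w (n - k)) * h (n - k))|
          ≤ ε * τ * M + G * H := by
        calc |∑ k ∈ Finset.range (n + 1), T k * ((w n - w (n - k)) * h (n - k))|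
            ≤ ∑ k ∈ Finset.range (n + 1), |T k * ((w n - w (n - k)) * h (n - k))| :=
              Finset.abs_sum_le_sum_abs _ _
          _ ≤ ∑ k ∈ Finset.range (n + 1), (T k * (ε * M) + G * H / ((n : ℝ) + 1)) := by
              refine Finset.sum_le_sum fun k hk => ?_
              have hk' : k ≤ n := by simpa [Nat.lt_succ_iff] using hk
              rw [abs_mul, abs_mul, abs_of_nonneg (hT0 k),
                abs_of_nonneg (sub_nonneg.2 (hwm (Nat.sub_le n k)))]
              exact hterm n k hk'
          _ = (∑ k ∈ Finset.range (n + 1), T k) * (ε * M) + G * H := by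
              rw [Finset.sum_add_distrib, ← Finset.sum_mul]
              simp only [Finset.sum_const, Finset.card_range, nsmul_eq_mul]
              push_cast
              field_simp
          _ ≤ τ * (ε * M) + G * H := by gcongr; exact hTs _
          _ = ε * τ * M + G * H := by ring
      rw [h1]
      exact (abs_sub _ _).trans (add_le_add h2 h3)
    have hMle : M ≤ β * (1 + G) * H + M / 2 := by
      refine ciSup_le fun n => ?_
      have h1 := eq_conv_of_conv_eq (h := fun n => w n * h n) (ρ := σ) hTb (fun n => rfl) n
      have h2 := abs_conv_le hbs hσb n
      rw [← h1, abs_mul, abs_of_pos (hw0 n)] at h2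
      calc f n ≤ β * (H + (ε * τ * M + G * H)) := h2
        _ = β * (1 + G) * H + β * (ε * τ) * M := by ring
        _ ≤ β * (1 + G) * H + 1 / 2 * M := by gcongr
        _ = _ := by ring
    intro n
    have := hfM n
    simp only [hf, hw, hφ] at this
    linarith
  intro n
  have hn1 : (0 : ℝ) < ((n : ℝ) + 1) ^ r := by positivity
  have := key _ hn1 n
  rw [min_self] at this
  rw [le_div_iff₀ hn1]
  linarith

/-! ### Tails of polynomially decaying sequences -/

/-- A discrete form of comparison with an integral: `log ((a + 1) / a) ≥ 1 / (a + 1)` and `exp u ≥ 1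
+ u` give the bound with `a + 1` on the left, and returning to `a` costs the factor `2 ^ (s + 1)`.
-/
theorem telescoping_rpow_bound {s : ℝ} (hs : 0 < s) (m : ℕ) :
    1 / ((m : ℝ) + 1) ^ (s + 1) ≤
      2 ^ (s + 1) / s * (1 / ((m : ℝ) + 1) ^ s - 1 / ((m : ℝ) + 1 + 1) ^ s) := by
  have hm : (0 : ℝ) < (m : ℝ) + 1 := by positivity
  have hm2 : (0 : ℝ) < (m : ℝ) + 1 + 1 := by positivity
  set a : ℝ := ((m : ℝ) + 1) with ha
  have h1 : 1 + s / (a + 1) ≤ ((a + 1) / a) ^ s := by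
    have hlog : 1 / (a + 1) ≤ Real.log ((a + 1) / a) := by
      have := Real.one_sub_inv_le_log_of_pos (x := (a + 1) / a) (by positivity)
      refine le_trans (le_of_eq ?_) this
      field_simp
      ring
    rw [Real.rpow_def_of_pos (by positivity)]
    have h2 := Real.add_one_le_exp (Real.log ((a + 1) / a) * s)
    have h3 : s / (a + 1) ≤ Real.log ((a + 1) / a) * s := by
      calc s / (a + 1) = 1 / (a + 1) * s := by ring
        _ ≤ _ := by gcongr
    linarith
  have h4 : s / (a + 1) ^ (s + 1) ≤ 1 / a ^ s - 1 / (a + 1) ^ s := by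
    rw [Real.div_rpow hm2.le hm.le] at h1
    have p1 := Real.rpow_pos_of_pos hm s
    have p2 := Real.rpow_pos_of_pos hm2 s
    have : s / (a + 1) ^ (s + 1) = (1 + s / (a + 1)) / (a + 1) ^ s - 1 / (a + 1) ^ s := by
      rw [Real.rpow_add_one hm2.ne']
      field_simp
      ring
    rw [this]
    have h5 : (1 + s / (a + 1)) / (a + 1) ^ s ≤ (a + 1) ^ s / a ^ s / (a + 1) ^ s := by gcongr
    have h6 : (a + 1) ^ s / a ^ s / (a + 1) ^ s = 1 / a ^ s := by field_simp
    linarith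
  have h7 : 1 / a ^ (s + 1) ≤ 2 ^ (s + 1) / (a + 1) ^ (s + 1) := by
    rw [← Real.div_rpow (by norm_num) hm2.le, one_div, ← Real.inv_rpow hm.le]
    refine Real.rpow_le_rpow (by positivity) ?_ (by linarith)
    rw [inv_eq_one_div, div_le_div_iff₀ hm hm2]
    have : (0 : ℝ) ≤ m := Nat.cast_nonneg m
    linarith
  calc 1 / a ^ (s + 1) ≤ 2 ^ (s + 1) / (a + 1) ^ (s + 1) := h7
    _ = 2 ^ (s + 1) / s * (s / (a + 1) ^ (s + 1)) := by field_simp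
    _ ≤ _ := by gcongr

theorem hasSum_telescoping_rpow {s : ℝ} (hs : 0 < s) (n : ℕ) :
    HasSum (fun j : ℕ => 1 / (((n + j : ℕ) : ℝ) + 1) ^ s - 1 / (((n + j : ℕ) : ℝ) + 1 + 1) ^ s)
      (1 / ((n : ℝ) + 1) ^ s) := by
  have hlim : Filter.Tendsto (fun j : ℕ => 1 / (((n + j : ℕ) : ℝ) + 1) ^ s) Filter.atTop
      (nhds 0) := by
    have h1 : Filter.Tendsto (fun x : ℝ => 1 / x ^ s) Filter.atTop (nhds 0) := by
      simp only [one_div]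
      exact (tendsto_rpow_atTop hs).inv_tendsto_atTop
    refine h1.comp ?_
    refine Filter.tendsto_atTop_add_const_right _ _ ?_
    refine tendsto_natCast_atTop_atTop.comp ?_
    simpa only [add_comm] using Filter.tendsto_add_atTop_nat n
  have hnonneg : ∀ j : ℕ, 0 ≤ 1 / (((n + j : ℕ) : ℝ) + 1) ^ s -
      1 / (((n + j : ℕ) : ℝ) + 1 + 1) ^ s := fun j => by
    rw [sub_nonneg]
    refine one_div_le_one_div_of_le (by positivity) ?_
    exact Real.rpow_le_rpow (by positivity) (by linarith) hs.le
  rw [hasSum_iff_tendsto_nat_of_nonneg hnonneg]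
  have hsum : ∀ N : ℕ, ∑ j ∈ Finset.range N, (1 / (((n + j : ℕ) : ℝ) + 1) ^ s -
      1 / (((n + j : ℕ) : ℝ) + 1 + 1) ^ s) =
      1 / ((n : ℝ) + 1) ^ s - 1 / (((n + N : ℕ) : ℝ) + 1) ^ s := by
    intro N
    have := Finset.sum_range_sub' (fun j : ℕ => 1 / (((n + j : ℕ) : ℝ) + 1) ^ s) N
    simp only [add_zero] at this
    rw [← this]
    refine Finset.sum_congr rfl fun j _ => ?_
    push_cast
    ring_nf
  simp only [hsum]
  simpa using (tendsto_const_nhds (x := 1 / ((n : ℝ) + 1) ^ s)).sub hlim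

theorem summable_of_le_rpow {a : ℕ → ℝ} {s A : ℝ} (hs : 0 < s) (ha0 : ∀ n, 0 ≤ a n)
    (ha : ∀ n : ℕ, a n ≤ A / ((n : ℝ) + 1) ^ (s + 1)) : Summable a := by
  have hA : 0 ≤ A := by simpa using (ha0 0).trans (ha 0)
  have h := (hasSum_telescoping_rpow hs 0).summable.mul_left (A * (2 ^ (s + 1) / s))
  refine Summable.of_nonneg_of_le ha0 (fun n => (ha n).trans ?_) h
  rw [mul_assoc, zero_add, div_eq_mul_one_div]
  exact mul_le_mul_of_nonneg_left (telescoping_rpow_bound hs n) hA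

theorem tsum_tail_le_of_le_rpow {a : ℕ → ℝ} {s A : ℝ} (hs : 0 < s) (ha0 : ∀ n, 0 ≤ a n)
    (ha : ∀ n : ℕ, a n ≤ A / ((n : ℝ) + 1) ^ (s + 1)) (n : ℕ) :
    ∑' j, a (n + j) ≤ A * (2 ^ (s + 1) / s) / ((n : ℝ) + 1) ^ s := by
  have hA : 0 ≤ A := by simpa using (ha0 0).trans (ha 0)
  have h := (hasSum_telescoping_rpow hs n).mul_left (A * (2 ^ (s + 1) / s))
  rw [div_eq_mul_one_div, ← h.tsum_eq]
  refine Summable.tsum_le_tsum (fun j => (ha (n + j)).trans ?_) ?_ h.summable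
  · rw [mul_assoc, div_eq_mul_one_div A]
    exact mul_le_mul_of_nonneg_left (telescoping_rpow_bound hs (n + j)) hA
  · have := (summable_nat_add_iff n).2 (summable_of_le_rpow hs ha0 ha)
    simpa only [add_comm] using this

/-! ### The excursion law of the renewal chain -/

/-- The probability that the excursion from `0` has length more than `n`. -/
noncomputable def renewalTail (p : ℝ) (n : ℕ) : ℝ := ∑' j : ℕ, renewalProb p 0 (n + j)

/-- The mean length of an excursion from `0`. -/
noncomputable def renewalMean (p : ℝ) : ℝ := ∑' n : ℕ, renewalTail p n

section Tail

variable {p : ℝ}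

theorem summable_realZeta (hp : 1 < p) : Summable fun k : ℕ => 1 / ((k : ℝ) + 1) ^ (p + 1) :=
  summable_of_le_rpow (s := p) (A := 1) (by linarith) (fun n => by positivity) fun n => le_rfl

theorem realZeta_pos (hp : 1 < p) : 0 < realZeta (p + 1) :=
  (summable_realZeta hp).tsum_pos (fun n => by positivity) 0 (by simp)

theorem renewalProb_zero_eq (hp : 1 < p) (n : ℕ) :
    renewalProb p 0 n = (realZeta (p + 1))⁻¹ * (1 / (n : ℝ) ^ (p + 1)) := by
  rcases n with _ | n
  · simp [renewalProb, Real.zero_rpow (by linarith : p + 1 ≠ 0)]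
  · simp [renewalProb, mul_comm]

theorem renewalProb_zero_nonneg (hp : 1 < p) (n : ℕ) : 0 ≤ renewalProb p 0 n := by
  have := realZeta_pos hp
  rw [renewalProb_zero_eq hp]
  positivity

theorem renewalProb_zero_zero : renewalProb p 0 0 = 0 := by simp [renewalProb]

theorem renewalProb_zero_succ_pos (hp : 1 < p) (n : ℕ) : 0 < renewalProb p 0 (n + 1) := by
  have := realZeta_pos hp
  rw [renewalProb_zero_eq hp]
  positivity

theorem hasSum_renewalProb_zero (hp : 1 < p) : HasSum (renewalProb p 0) 1 := by
  rw [← hasSum_nat_add_iff' 1]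
  have h := (summable_realZeta hp).hasSum.mul_left (realZeta (p + 1))⁻¹
  have h1 : (realZeta (p + 1))⁻¹ * ∑' k : ℕ, 1 / ((k : ℝ) + 1) ^ (p + 1) = 1 :=
    inv_mul_cancel₀ (realZeta_pos hp).ne'
  rw [h1] at h
  simp only [Finset.sum_range_one, renewalProb_zero_zero, sub_zero]
  simpa [renewalProb_zero_eq hp] using h

theorem renewalProb_zero_le (hp : 1 < p) (n : ℕ) :
    renewalProb p 0 n ≤ (realZeta (p + 1))⁻¹ * 2 ^ (p + 1) / ((n : ℝ) + 1) ^ (p + 1) := by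
  have hz := realZeta_pos hp
  rcases n with _ | n
  · rw [renewalProb_zero_zero]; positivity
  · rw [renewalProb_zero_eq hp, mul_div_assoc]
    refine mul_le_mul_of_nonneg_left ?_ (by positivity)
    rw [one_div, ← Real.inv_rpow (by positivity), ← Real.div_rpow (by norm_num) (by positivity)]
    refine Real.rpow_le_rpow (by positivity) ?_ (by linarith)
    push_cast
    rw [inv_eq_one_div, div_le_div_iff₀ (by positivity) (by positivity)]
    have : (0 : ℝ) ≤ n := Nat.cast_nonneg n
    linarith

theorem summable_renewalProb_zero_add (hp : 1 < p) (n : ℕ) :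
    Summable fun j : ℕ => renewalProb p 0 (n + j) := by
  have := (summable_nat_add_iff n).2 (hasSum_renewalProb_zero hp).summable
  simpa only [add_comm] using this

theorem renewalTail_nonneg (hp : 1 < p) (n : ℕ) : 0 ≤ renewalTail p n :=
  tsum_nonneg fun _ => renewalProb_zero_nonneg hp _

theorem renewalTail_zero (hp : 1 < p) : renewalTail p 0 = 1 := by
  simpa [renewalTail] using (hasSum_renewalProb_zero hp).tsum_eq

theorem renewalTail_eq_add (hp : 1 < p) (n : ℕ) :
    renewalTail p n = renewalProb p 0 n + renewalTail p (n + 1) := by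
  rw [renewalTail, (summable_renewalProb_zero_add hp n).tsum_eq_zero_add, renewalTail, add_zero]
  congr 1
  exact tsum_congr fun j => by congr 1; ring

theorem renewalTail_antitone (hp : 1 < p) : Antitone (renewalTail p) :=
  antitone_nat_of_succ_le fun n => by
    have := renewalTail_eq_add hp n
    have := renewalProb_zero_nonneg hp n
    linarith

theorem exists_renewalTail_le (hp : 1 < p) :
    ∃ C : ℝ, 0 < C ∧ ∀ n : ℕ, renewalTail p n ≤ C / ((n : ℝ) + 1) ^ p := by
  have hz := realZeta_pos hp
  exact ⟨_, by positivity, tsum_tail_le_of_le_rpow (by linarith) (renewalProb_zero_nonneg hp)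
    (renewalProb_zero_le hp)⟩

theorem exists_le_renewalTail (hp : 1 < p) :
    ∃ c : ℝ, 0 < c ∧ ∀ n : ℕ, c / ((n : ℝ) + 1) ^ p ≤ renewalTail p n := by
  have hz := realZeta_pos hp
  refine ⟨(realZeta (p + 1))⁻¹ / 2 ^ (p + 1), by positivity, fun n => ?_⟩
  have hn : (0 : ℝ) < (n : ℝ) + 1 := by positivity
  -- Starting at `n + 1` avoids the vanishing term at index 0. The block of `n + 1` indices from `n
  -- + 1` to `2 n + 1` already carries mass of the right order.
  refine le_trans ?_ (renewalTail_antitone hp (Nat.le_succ n))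
  refine le_trans ?_ ((summable_renewalProb_zero_add hp (n + 1)).sum_le_tsum
    (Finset.range (n + 1)) fun _ _ => renewalProb_zero_nonneg hp _)
  have hterm : ∀ j ∈ Finset.range (n + 1),
      (realZeta (p + 1))⁻¹ * (1 / (2 * ((n : ℝ) + 1)) ^ (p + 1)) ≤ renewalProb p 0 (n + 1 + j) := by
    intro j hj
    have hj' : (j : ℝ) ≤ n := by
      have := Finset.mem_range.1 hj
      exact_mod_cast Nat.lt_succ_iff.1 this
    rw [renewalProb_zero_eq hp]
    push_cast
    gcongr
    linarith
  refine le_trans (le_of_eq ?_) (Finset.card_nsmul_le_sum _ _ _ hterm)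
  rw [Finset.card_range, nsmul_eq_mul, Real.mul_rpow (by norm_num) hn.le,
    Real.rpow_add_one hn.ne' p]
  push_cast
  have := (Real.rpow_pos_of_pos hn p).ne'
  field_simp

theorem summable_renewalTail (hp : 1 < p) : Summable (renewalTail p) := by
  obtain ⟨C, -, hC⟩ := exists_renewalTail_le hp
  refine summable_of_le_rpow (s := p - 1) (A := C) (by linarith) (renewalTail_nonneg hp) fun n => ?_
  simpa using hC n

theorem exists_tsum_renewalTail_le (hp : 1 < p) :
    ∃ C : ℝ, 0 < C ∧ ∀ n : ℕ, ∑' j, renewalTail p (n + j) ≤ C / ((n : ℝ) + 1) ^ (p - 1) := by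
  obtain ⟨C, hC0, hC⟩ := exists_renewalTail_le hp
  have hp1 : 0 < p - 1 := by linarith
  exact ⟨_, by positivity, tsum_tail_le_of_le_rpow (A := C) hp1 (renewalTail_nonneg hp)
    fun n => by simpa using hC n⟩

theorem one_le_renewalMean (hp : 1 < p) : 1 ≤ renewalMean p := by
  rw [← renewalTail_zero hp]
  exact (summable_renewalTail hp).le_tsum 0 fun _ _ => renewalTail_nonneg hp _

theorem renewalWeight_eq (hp : 1 < p) (n : ℕ) :
    renewalWeight p n = realZeta (p + 1) * renewalTail p n := by
  have hz := (realZeta_pos hp).ne'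
  have h1 : ∀ m, renewalTail p m = (realZeta (p + 1))⁻¹ *
      ∑' j : ℕ, 1 / ((m + j : ℕ) : ℝ) ^ (p + 1) := fun m => by
    rw [renewalTail, ← tsum_mul_left]
    exact tsum_congr fun j => renewalProb_zero_eq hp _
  rcases n with _ | n
  · have h2 : renewalTail p 0 = renewalTail p 1 := by
      rw [renewalTail_eq_add hp, renewalProb_zero_zero, zero_add]
    rw [h2, h1, mul_inv_cancel_left₀ hz]
    rfl
  · rw [h1, mul_inv_cancel_left₀ hz, renewalWeight, max_eq_left (by omega)]

theorem normalized_renewalWeight_eq (hp : 1 < p) (n : ℕ) :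
    (∑' k, renewalWeight p k)⁻¹ * renewalWeight p n = renewalTail p n / renewalMean p := by
  have hz := (realZeta_pos hp).ne'
  have h : ∑' k, renewalWeight p k = realZeta (p + 1) * renewalMean p := by
    rw [renewalMean, ← tsum_mul_left]
    exact tsum_congr fun k => renewalWeight_eq hp k
  rw [h, renewalWeight_eq hp]
  field_simp

theorem complex_eq_one_of_re_eq_one {w : ℂ} (hw : ‖w‖ ≤ 1) (hre : w.re = 1) : w = 1 := by
  have h := Complex.sq_norm w
  rw [Complex.normSq_apply, hre] at h
  have : w.im = 0 := by nlinarith [norm_nonneg w, sq_nonneg w.im]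
  exact Complex.ext hre this

theorem tsum_renewalTail_mul_pow_ne_zero (hp : 1 < p) {z : ℂ} (hz : ‖z‖ ≤ 1) :
    ∑' n, (renewalTail p n : ℂ) * z ^ n ≠ 0 := by
  intro h0
  have hpow : ∀ n : ℕ, ‖z ^ n‖ ≤ 1 := fun n => by
    rw [norm_pow]; exact pow_le_one₀ (norm_nonneg _) hz
  have hre : ∀ n : ℕ, (z ^ n).re ≤ 1 := fun n => (Complex.re_le_norm _).trans (hpow n)
  have hTs : Summable fun n => (renewalTail p n : ℂ) * z ^ n := by
    refine Summable.of_norm_bounded (summable_renewalTail hp) fun n => ?_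
    rw [norm_mul, Complex.norm_real, Real.norm_of_nonneg (renewalTail_nonneg hp n)]
    exact mul_le_of_le_one_right (renewalTail_nonneg hp n) (hpow n)
  have hqs : Summable fun n => (renewalProb p 0 n : ℂ) * z ^ (n + 1) := by
    refine Summable.of_norm_bounded (hasSum_renewalProb_zero hp).summable fun n => ?_
    rw [norm_mul, Complex.norm_real, Real.norm_of_nonneg (renewalProb_zero_nonneg hp n)]
    exact mul_le_of_le_one_right (renewalProb_zero_nonneg hp n) (hpow _)
  -- Summation by parts, that is `(1 - z) T(z) = 1 - ∑ q n z ^ (n + 1)`, at a zero of `T`.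
  have hq1 : ∑' n, (renewalProb p 0 n : ℂ) * z ^ (n + 1) = 1 := by
    have h1 : ∑' n, (renewalTail p (n + 1) : ℂ) * z ^ (n + 1) = -1 := by
      have := hTs.tsum_eq_zero_add
      rw [h0, renewalTail_zero hp] at this
      simp only [Complex.ofReal_one, pow_zero, mul_one] at this
      linear_combination -this
    have h2 : ∑' n, (renewalTail p n : ℂ) * z ^ (n + 1) = 0 := by
      have : ∀ n, (renewalTail p n : ℂ) * z ^ (n + 1) = (renewalTail p n : ℂ) * z ^ n * z :=
        fun n => by ring
      simp only [this]
      rw [tsum_mul_right, h0, zero_mul]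
    have h3 : ∀ n, (renewalTail p n : ℂ) * z ^ (n + 1) = (renewalProb p 0 n : ℂ) * z ^ (n + 1) +
        (renewalTail p (n + 1) : ℂ) * z ^ (n + 1) := fun n => by
      rw [renewalTail_eq_add hp n]; push_cast; ring
    simp only [h3] at h2
    rw [Summable.tsum_add hqs ((summable_nat_add_iff 1).2 hTs), h1] at h2
    linear_combination h2
  have hre1 : ∑' n, renewalProb p 0 n * (z ^ (n + 1)).re = 1 := by
    have := congrArg Complex.re hq1
    rw [Complex.re_tsum hqs] at this
    simpa using this
  have hres : Summable fun n => renewalProb p 0 n * (z ^ (n + 1)).re := by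
    have := (Complex.reCLM.summable hqs)
    simpa using this
  have hdiff : ∑' n, (renewalProb p 0 n - renewalProb p 0 n * (z ^ (n + 1)).re) = 0 := by
    rw [Summable.tsum_sub (hasSum_renewalProb_zero hp).summable hres,
      (hasSum_renewalProb_zero hp).tsum_eq, hre1, sub_self]
  have hnn : ∀ n, 0 ≤ renewalProb p 0 n - renewalProb p 0 n * (z ^ (n + 1)).re := fun n => by
    have := mul_le_mul_of_nonneg_left (hre (n + 1)) (renewalProb_zero_nonneg hp n)
    linarith
  -- An average of numbers at most 1 equals 1, so each number of positive weight equals 1. The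
  -- weight is positive from index 1 on, which yields `z ^ 2 = z ^ 3 = 1`.
  have hzero : ∀ n, renewalProb p 0 n - renewalProb p 0 n * (z ^ (n + 1)).re = 0 := fun n => by
    have := (((hasSum_renewalProb_zero hp).summable.sub hres).hasSum_iff.2 hdiff)
    exact congrFun ((hasSum_zero_iff_of_nonneg hnn).1 this) n
  have hpow1 : ∀ n, z ^ (n + 1 + 1) = 1 := fun n => by
    refine complex_eq_one_of_re_eq_one (hpow _) ?_
    have h1 := hzero (n + 1)
    have h2 := renewalProb_zero_succ_pos hp n
    have h3 : renewalProb p 0 (n + 1) * (1 - (z ^ (n + 1 + 1)).re) = 0 := by linarith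
    rcases mul_eq_zero.1 h3 with h | h <;> linarith
  have hz1 : z = 1 := by
    have h2 := hpow1 0
    have h3 := hpow1 1
    calc z = z ^ (1 + 1 + 1) := by rw [pow_succ, hpow1 0, one_mul]
      _ = 1 := h3
  subst hz1
  have h1 : ∑' n, (renewalTail p n : ℂ) * 1 ^ n = (renewalMean p : ℂ) := by
    rw [renewalMean, Complex.ofReal_tsum]
    exact tsum_congr fun n => by simp
  rw [h1] at h0
  have := one_le_renewalMean hp
  have h2 : renewalMean p = 0 := by exact_mod_cast h0
  linarith

end Tail

/-! ### The renewal kernel and its invariant measure -/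

theorem sum_ofReal_smul_dirac_singleton (a : ℕ → ℝ) (k : ℕ) :
    (Measure.sum fun n => ENNReal.ofReal (a n) • Measure.dirac n) {k} = ENNReal.ofReal (a k) := by
  rw [Measure.sum_apply _ (measurableSet_singleton k), tsum_eq_single k]
  · simp
  · intro n hn
    simp [hn]

theorem isProbabilityMeasure_sum_ofReal_smul_dirac {a : ℕ → ℝ} (ha : ∀ n, 0 ≤ a n)
    (h : HasSum a 1) :
    IsProbabilityMeasure (Measure.sum fun n => ENNReal.ofReal (a n) • Measure.dirac n) := by
  refine ⟨?_⟩
  rw [Measure.sum_apply _ MeasurableSet.univ]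
  simp only [Measure.smul_apply, measure_univ, smul_eq_mul, mul_one]
  rw [← ENNReal.ofReal_tsum_of_nonneg ha h.summable, h.tsum_eq, ENNReal.ofReal_one]

section Kernel

variable {p : ℝ}

theorem renewalKernel_singleton (m k : ℕ) :
    renewalKernel p m {k} = ENNReal.ofReal (renewalProb p m k) :=
  sum_ofReal_smul_dirac_singleton _ _

theorem renewalKernel_succ (m : ℕ) : renewalKernel p (m + 1) = Measure.dirac m := by
  refine Measure.ext_of_singleton fun k => ?_
  rw [renewalKernel_singleton, Measure.dirac_apply' _ (measurableSet_singleton k)]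
  by_cases h : k = m <;> simp [renewalProb, h, Ne.symm]

theorem isMarkovKernel_renewalKernel (hp : 1 < p) : IsMarkovKernel (renewalKernel p) := by
  refine ⟨fun m => ?_⟩
  rcases m with _ | m
  · exact isProbabilityMeasure_sum_ofReal_smul_dirac (renewalProb_zero_nonneg hp)
      (hasSum_renewalProb_zero hp)
  · rw [renewalKernel_succ]; infer_instance

theorem renewalMeasure_singleton (hp : 1 < p) (n : ℕ) :
    renewalMeasure p {n} = ENNReal.ofReal (renewalTail p n / renewalMean p) := by
  rw [← normalized_renewalWeight_eq hp]
  exact sum_ofReal_smul_dirac_singleton _ _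

theorem renewalMeasure_real_singleton (hp : 1 < p) (n : ℕ) :
    (renewalMeasure p).real {n} = renewalTail p n / renewalMean p := by
  rw [measureReal_def, renewalMeasure_singleton hp, ENNReal.toReal_ofReal]
  exact div_nonneg (renewalTail_nonneg hp n) (zero_le_one.trans (one_le_renewalMean hp))

theorem isProbabilityMeasure_renewalMeasure (hp : 1 < p) :
    IsProbabilityMeasure (renewalMeasure p) := by
  have hμ := one_le_renewalMean hp
  have h : HasSum (fun n => renewalTail p n / renewalMean p) 1 := by
    have := (summable_renewalTail hp).hasSum.div_const (renewalMean p)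
    rwa [← renewalMean, div_self (by linarith)] at this
  simp only [renewalMeasure, normalized_renewalWeight_eq hp]
  exact isProbabilityMeasure_sum_ofReal_smul_dirac
    (fun n => div_nonneg (renewalTail_nonneg hp n) (by linarith)) h

/-- State `k` is entered only from 0 and from `k + 1`, so balance is `q k * T 0 + T (k + 1) = T k`.
-/
theorem renewalMeasure_invariant (hp : 1 < p) :
    (renewalKernel p).Invariant (renewalMeasure p) := by
  have hμ : 0 < renewalMean p := zero_lt_one.trans_le (one_le_renewalMean hp)
  refine Measure.ext_of_singleton fun k => ?_
  rw [Measure.bind_apply (measurableSet_singleton k) (Kernel.aemeasurable _), lintegral_countable',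
    tsum_eq_zero_add' ENNReal.summable, tsum_eq_single k]
  · rw [renewalKernel_singleton, renewalKernel_singleton, renewalMeasure_singleton hp,
      renewalMeasure_singleton hp, renewalMeasure_singleton hp, renewalTail_zero hp,
      ← ENNReal.ofReal_mul (renewalProb_zero_nonneg hp k)]
    have hk : renewalProb p (k + 1) k = 1 := by simp [renewalProb]
    rw [hk, ENNReal.ofReal_one, one_mul, ← ENNReal.ofReal_add
      (mul_nonneg (renewalProb_zero_nonneg hp k) (by positivity))
      (div_nonneg (renewalTail_nonneg hp _) hμ.le), renewalTail_eq_add hp k]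
    congr 1
    ring
  · intro m hm
    rw [renewalKernel_singleton]
    simp [renewalProb, hm.symm]

/-! ### The transition operator on bounded functions and its decay -/

theorem integrable_of_abs_le {μ : Measure ℕ} [IsFiniteMeasure μ] {g : ℕ → ℝ} {H : ℝ}
    (hg : ∀ m, |g m| ≤ H) : Integrable g μ :=
  Integrable.of_bound (measurable_of_countable g).aestronglyMeasurable H
    (Filter.Eventually.of_forall hg)

theorem transitionOp_succ (g : ℕ → ℝ) (m : ℕ) :
    transitionOp (renewalKernel p) g (m + 1) = g m := by
  rw [transitionOp, renewalKernel_succ, integral_dirac]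

/-- From `m` the chain descends deterministically and reaches 0 at time `m`, so all iterates are
determined by their values at 0. -/
theorem transitionOp_iterate_apply (g : ℕ → ℝ) (n m : ℕ) :
    (transitionOp (renewalKernel p))^[n] g m =
      if m ≤ n then (transitionOp (renewalKernel p))^[n - m] g 0 else g (m - n) := by
  induction n generalizing m with
  | zero =>
    rcases m with _ | m <;> simp
  | succ n ih =>
    rcases m with _ | m
    · simp
    · rw [Function.iterate_succ_apply', transitionOp_succ, ih]
      simp

theorem abs_transitionOp_le (hp : 1 < p) {g : ℕ → ℝ} {H : ℝ} (hg : ∀ m, |g m| ≤ H) (m : ℕ) :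
    |transitionOp (renewalKernel p) g m| ≤ H := by
  have := isMarkovKernel_renewalKernel hp
  have h := norm_integral_le_of_norm_le_const (μ := renewalKernel p m) (f := g) (C := H)
    (Filter.Eventually.of_forall hg)
  simpa [transitionOp] using h

theorem abs_transitionOp_iterate_le (hp : 1 < p) {g : ℕ → ℝ} {H : ℝ} (hg : ∀ m, |g m| ≤ H)
    (n m : ℕ) : |(transitionOp (renewalKernel p))^[n] g m| ≤ H := by
  induction n generalizing m with
  | zero => exact hg m
  | succ n ih =>
    rw [Function.iterate_succ_apply']
    exact abs_transitionOp_le hp ih m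

theorem transitionOp_iterate_sub_const (hp : 1 < p) {g : ℕ → ℝ} {H : ℝ} (hg : ∀ m, |g m| ≤ H)
    (c : ℝ) (n m : ℕ) : (transitionOp (renewalKernel p))^[n] (fun k => g k - c) m =
      (transitionOp (renewalKernel p))^[n] g m - c := by
  have := isMarkovKernel_renewalKernel hp
  induction n generalizing m with
  | zero => rfl
  | succ n ih =>
    rw [Function.iterate_succ_apply', Function.iterate_succ_apply', funext ih]
    simp only [transitionOp]
    rw [integral_sub (integrable_of_abs_le (abs_transitionOp_iterate_le hp hg n))
      (integrable_const c)]
    simp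

theorem integral_transitionOp (hp : 1 < p) {g : ℕ → ℝ} {H : ℝ} (hg : ∀ m, |g m| ≤ H) :
    ∫ m, transitionOp (renewalKernel p) g m ∂(renewalMeasure p) =
      ∫ m, g m ∂(renewalMeasure p) := by
  have := isMarkovKernel_renewalKernel hp
  have := isProbabilityMeasure_renewalMeasure hp
  have h := renewalMeasure_invariant hp
  conv_rhs => rw [← h.def, Measure.comp_eq_comp_const_apply]
  rw [Kernel.integral_comp (integrable_of_abs_le hg)]
  rfl

theorem integral_transitionOp_iterate (hp : 1 < p) {g : ℕ → ℝ} {H : ℝ} (hg : ∀ m, |g m| ≤ H)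
    (n : ℕ) : ∫ m, (transitionOp (renewalKernel p))^[n] g m ∂(renewalMeasure p) =
      ∫ m, g m ∂(renewalMeasure p) := by
  induction n with
  | zero => rfl
  | succ n ih =>
    rw [← ih, Function.iterate_succ_apply']
    exact integral_transitionOp hp (abs_transitionOp_iterate_le hp hg n)

theorem integral_renewalMeasure (hp : 1 < p) {g : ℕ → ℝ} {H : ℝ} (hg : ∀ m, |g m| ≤ H) :
    ∫ m, g m ∂(renewalMeasure p) = (∑' m, renewalTail p m * g m) / renewalMean p := by
  have := isProbabilityMeasure_renewalMeasure hp
  rw [integral_countable (integrable_of_abs_le hg), ← tsum_div_const]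
  refine tsum_congr fun m => ?_
  rw [renewalMeasure_real_singleton hp, smul_eq_mul]
  ring

theorem summable_renewalTail_mul (hp : 1 < p) {g : ℕ → ℝ} {H : ℝ} (hg : ∀ m, |g m| ≤ H) :
    Summable fun m => renewalTail p m * g m := by
  refine Summable.of_norm_bounded ((summable_renewalTail hp).mul_right H) fun m => ?_
  rw [norm_mul, Real.norm_of_nonneg (renewalTail_nonneg hp m)]
  exact mul_le_mul_of_nonneg_left (hg m) (renewalTail_nonneg hp m)

theorem abs_tsum_renewalTail_mul_le (hp : 1 < p) {g : ℕ → ℝ} {H : ℝ} (hg : ∀ m, |g m| ≤ H)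
    (n : ℕ) : |∑' j, renewalTail p (n + j) * g j| ≤ (∑' j, renewalTail p (n + j)) * H := by
  have hs : Summable fun j => renewalTail p (n + j) := by
    have := (summable_nat_add_iff n).2 (summable_renewalTail hp)
    simpa only [add_comm] using this
  rw [← tsum_mul_right]
  refine tsum_of_norm_bounded (f := fun j => renewalTail p (n + j) * g j)
    (hs.mul_right H).hasSum fun j => ?_
  rw [norm_mul, Real.norm_of_nonneg (renewalTail_nonneg hp _)]
  exact mul_le_mul_of_nonneg_left (hg j) (renewalTail_nonneg hp _)

/-- The renewal equation for `h n = K ^ n g (0)`, for centred `g`. -/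
theorem sum_renewalTail_mul_transitionOp (hp : 1 < p) {g : ℕ → ℝ} {H : ℝ}
    (hg : ∀ m, |g m| ≤ H) (hg0 : ∫ m, g m ∂(renewalMeasure p) = 0) (n : ℕ) :
    ∑ k ∈ Finset.range (n + 1),
        renewalTail p k * (transitionOp (renewalKernel p))^[n - k] g 0 =
      -∑' j, renewalTail p (n + 1 + j) * g (j + 1) := by
  have hμ : 0 < renewalMean p := zero_lt_one.trans_le (one_le_renewalMean hp)
  have hb := abs_transitionOp_iterate_le hp hg n
  have h1 := integral_transitionOp_iterate hp hg n
  rw [hg0, integral_renewalMeasure hp hb, div_eq_zero_iff, or_iff_left hμ.ne',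
    ← (summable_renewalTail_mul hp hb).sum_add_tsum_nat_add (n + 1)] at h1
  have h2 : ∀ k ∈ Finset.range (n + 1),
      renewalTail p k * (transitionOp (renewalKernel p))^[n] g k =
        renewalTail p k * (transitionOp (renewalKernel p))^[n - k] g 0 := fun k hk => by
    rw [transitionOp_iterate_apply, if_pos (Nat.lt_succ_iff.1 (Finset.mem_range.1 hk))]
  have h3 : ∀ j, renewalTail p (j + (n + 1)) *
      (transitionOp (renewalKernel p))^[n] g (j + (n + 1)) =
        renewalTail p (n + 1 + j) * g (j + 1) := fun j => by
    rw [transitionOp_iterate_apply, if_neg (by omega), add_comm j (n + 1)]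
    congr 2
    omega
  rw [Finset.sum_congr rfl h2, tsum_congr h3] at h1
  linarith

/-- Polynomial decay of `K ^ n g (0)`, uniformly over centred `g`. -/
theorem exists_abs_transitionOp_iterate_zero_le (hp : 1 < p) :
    ∃ D : ℝ, 0 < D ∧ ∀ (g : ℕ → ℝ) (H : ℝ), (∀ m, |g m| ≤ H) →
      ∫ m, g m ∂(renewalMeasure p) = 0 → ∀ n : ℕ,
        |(transitionOp (renewalKernel p))^[n] g 0| ≤ D * H / ((n : ℝ) + 1) ^ (p - 1) := by
  obtain ⟨b, hb, hTb⟩ := exists_summable_powerSeries_inverse (T := renewalTail p)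
    (by simpa only [abs_of_nonneg (renewalTail_nonneg hp _)] using summable_renewalTail hp)
    (fun z hz => tsum_renewalTail_mul_pow_ne_zero hp hz)
  obtain ⟨C, hC0, hC⟩ := exists_renewalTail_le hp
  obtain ⟨C', hC'0, hC'⟩ := exists_tsum_renewalTail_le hp
  have hp1 : 0 < p - 1 := by linarith
  obtain ⟨D, hD0, hD⟩ := exists_decay_of_conv_eq (C := C) hp1 (renewalTail_nonneg hp)
    (summable_renewalTail hp) (fun n => by simpa using hC n) hb hTb
  -- The lemma uses one constant for both `h` and `ρ`; `(1 + C') * H` dominates the two bounds. The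
  -- final `+ 1` only ensures positivity.
  refine ⟨D * (1 + C') + 1, by positivity, fun g H hg hg0 n => ?_⟩
  have hH : 0 ≤ H := (abs_nonneg _).trans (hg 0)
  have h := hD (fun n => (transitionOp (renewalKernel p))^[n] g 0)
    (fun n => -∑' j, renewalTail p (n + 1 + j) * g (j + 1)) ((1 + C') * H)
    (sum_renewalTail_mul_transitionOp hp hg hg0)
    (fun n => (abs_transitionOp_iterate_le hp hg n 0).trans (by nlinarith)) ?_ n
  · refine h.trans ?_
    rw [← mul_assoc]
    gcongr
    linarith
  · intro n
    rw [abs_neg]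
    refine (abs_tsum_renewalTail_mul_le hp (fun m => hg (m + 1)) (n + 1)).trans ?_
    calc (∑' j, renewalTail p (n + 1 + j)) * H
        ≤ (C' / (((n + 1 : ℕ) : ℝ) + 1) ^ (p - 1)) * H := by gcongr; exact hC' _
      _ ≤ (C' / ((n : ℝ) + 1) ^ (p - 1)) * H := by
          gcongr
          linarith
      _ ≤ (1 + C') * H / ((n : ℝ) + 1) ^ (p - 1) := by
          rw [div_mul_eq_mul_div]
          gcongr
          linarith

theorem exists_integral_abs_transitionOp_iterate_le (hp : 1 < p) :
    ∃ D : ℝ, 0 < D ∧ ∀ (g : ℕ → ℝ) (H : ℝ), (∀ m, |g m| ≤ H) →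
      ∫ m, g m ∂(renewalMeasure p) = 0 → ∀ n : ℕ, 1 ≤ n →
        ∫ m, |(transitionOp (renewalKernel p))^[n] g m| ∂(renewalMeasure p) ≤
          D * H / (n : ℝ) ^ (p - 1) := by
  obtain ⟨D, hD0, hD⟩ := exists_abs_transitionOp_iterate_zero_le hp
  obtain ⟨C, hC0, hC⟩ := exists_tsum_renewalTail_le hp
  have hp1 : 0 < p - 1 := by linarith
  have hμ1 := one_le_renewalMean hp
  have hμ : 0 < renewalMean p := zero_lt_one.trans_le hμ1
  refine ⟨2 ^ (p - 1) * (D + C), by positivity, fun g H hg hg0 n hn => ?_⟩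
  have hH : 0 ≤ H := (abs_nonneg _).trans (hg 0)
  have hn0 : (0 : ℝ) < n := by exact_mod_cast hn
  have hpow : ∀ m : ℕ, n ≤ 2 * (m + 1) → (1 : ℝ) / ((m : ℝ) + 1) ^ (p - 1) ≤
      2 ^ (p - 1) / (n : ℝ) ^ (p - 1) := fun m hm => by
    have hm' : (n : ℝ) ≤ 2 * ((m : ℝ) + 1) := by exact_mod_cast hm
    rw [div_le_div_iff₀ (by positivity) (by positivity), one_mul,
      ← Real.mul_rpow (by norm_num) (by positivity)]
    exact Real.rpow_le_rpow hn0.le hm' hp1.le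
  -- For `k < N` the remaining time `n - k` is at least about `n / 2`, so the decay at 0 applies;
  -- the states from `N` on have `π`-mass `O(n ^ (1 - p))`, so boundedness is enough.
  set N : ℕ := n / 2 + 1 with hN
  have hb : ∀ m, |(|(transitionOp (renewalKernel p))^[n] g m|)| ≤ H := fun m => by
    rw [abs_abs]; exact abs_transitionOp_iterate_le hp hg n m
  rw [integral_renewalMeasure hp hb,
    ← (summable_renewalTail_mul hp hb).sum_add_tsum_nat_add N, div_le_iff₀ hμ]
  set A : ℝ := 2 ^ (p - 1) / (n : ℝ) ^ (p - 1) with hA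
  have hA0 : 0 ≤ A := by positivity
  have h1 : ∑ k ∈ Finset.range N, renewalTail p k * |(transitionOp (renewalKernel p))^[n] g k| ≤
      renewalMean p * (D * H * A) := by
    calc ∑ k ∈ Finset.range N, renewalTail p k * |(transitionOp (renewalKernel p))^[n] g k|
        ≤ ∑ k ∈ Finset.range N, renewalTail p k * (D * H * A) := by
          refine Finset.sum_le_sum fun k hk => ?_
          have hk' := Finset.mem_range.1 hk
          refine mul_le_mul_of_nonneg_left ?_ (renewalTail_nonneg hp k)
          rw [transitionOp_iterate_apply, if_pos (by omega)]
          refine (hD g H hg hg0 (n - k)).trans ?_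
          rw [div_eq_mul_one_div]
          exact mul_le_mul_of_nonneg_left (hpow _ (by omega)) (by positivity)
      _ = (∑ k ∈ Finset.range N, renewalTail p k) * (D * H * A) := by rw [Finset.sum_mul]
      _ ≤ renewalMean p * (D * H * A) := by
          gcongr
          exact (summable_renewalTail hp).sum_le_tsum _ fun _ _ => renewalTail_nonneg hp _
  have h2 : ∑' j, renewalTail p (j + N) * |(transitionOp (renewalKernel p))^[n] g (j + N)| ≤
      C * A * H := by
    have h3 := abs_tsum_renewalTail_mul_le hp (fun m => hb (m + N)) N
    simp only [add_comm N] at h3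
    refine (le_abs_self _).trans (h3.trans ?_)
    refine mul_le_mul_of_nonneg_right ?_ hH
    have h4 := hC N
    simp only [add_comm N] at h4
    refine h4.trans ?_
    rw [div_eq_mul_one_div]
    exact mul_le_mul_of_nonneg_left (hpow _ (by omega)) hC0.le
  have h3 : C * A * H ≤ renewalMean p * (C * A * H) :=
    le_mul_of_one_le_left (by positivity) hμ1
  calc _ ≤ renewalMean p * (D * H * A) + renewalMean p * (C * A * H) := by linarith
    _ = 2 ^ (p - 1) * (D + C) * H / (n : ℝ) ^ (p - 1) * renewalMean p := by
      rw [hA]; ring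

theorem abs_le_supNorm {g : ℕ → ℝ} (hg : g ∈ boundedFunctions ℕ) (m : ℕ) : |g m| ≤ supNorm g := by
  obtain ⟨-, C, hC⟩ := hg
  exact le_ciSup (f := fun m => |g m|) ⟨C, by rintro _ ⟨m, rfl⟩; exact hC m⟩ m

theorem conditionH_renewalKernel (hp : 1 < p) :
    ConditionH (renewalKernel p) (renewalMeasure p) (boundedFunctions ℕ) supNorm p := by
  have := isProbabilityMeasure_renewalMeasure hp
  constructor
  · obtain ⟨D, hD0, hD⟩ := exists_integral_abs_transitionOp_iterate_le hp
    refine ⟨2 * D, by positivity, fun g hg n hn => ?_⟩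
    have hg1 := abs_le_supNorm hg
    set c : ℝ := ∫ m, g m ∂(renewalMeasure p) with hc
    have hc1 : |c| ≤ supNorm g := by
      have h := norm_integral_le_of_norm_le_const (μ := renewalMeasure p) (f := g)
        (C := supNorm g) (Filter.Eventually.of_forall hg1)
      simpa using h
    have h0 : ∫ m, (g m - c) ∂(renewalMeasure p) = 0 := by
      rw [integral_sub (integrable_of_abs_le hg1) (integrable_const c)]
      simp [← hc]
    -- Centring at most doubles the supremum norm, whence the constant `2 * D`.
    have h := hD (fun m => g m - c) (2 * supNorm g)
      (fun m => (abs_sub _ _).trans (by linarith [hg1 m])) h0 n hn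
    simp only [transitionOp_iterate_sub_const hp hg1] at h
    refine h.trans (le_of_eq ?_)
    ring
  · refine ⟨1, one_pos, fun g hg n => ?_⟩
    have h := abs_transitionOp_iterate_le hp (abs_le_supNorm hg) n
    refine ⟨⟨measurable_of_countable _, _, h⟩, ?_⟩
    rw [one_mul]
    exact ciSup_le h

theorem integral_renewalObservable (hp : 1 < p) :
    ∫ m, renewalObservable p m ∂(renewalMeasure p) = 0 := by
  have := isProbabilityMeasure_renewalMeasure hp
  have h : ∀ m : ℕ, renewalObservable p m =
      (renewalMeasure p).real {0} - Set.indicator {0} (fun _ => (1 : ℝ)) m := fun m => by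
    simp [renewalObservable, Set.indicator_apply]
  simp only [h]
  rw [integral_sub (integrable_const _)
    ((integrable_const _).indicator (measurableSet_singleton 0)),
    integral_indicator (measurableSet_singleton 0)]
  simp [measureReal_def]

end Kernel

/-! ### Sums of independent bounded variables -/

section Moments

variable {Ω : Type*} [MeasurableSpace Ω] {μ : Measure Ω} [IsProbabilityMeasure μ]

/-- A centred variable with comparable second and fourth moments is nonnegative with a probability
that is bounded below. -/
theorem le_measureReal_nonneg_of_fourth_moment {S : Ω → ℝ} {V : ℝ} (hS : Measurable S) (hV : 0 < V)
    (i1 : Integrable S μ) (i2 : Integrable (fun ω => S ω ^ 2) μ)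
    (i4 : Integrable (fun ω => S ω ^ 4) μ) (h1 : ∫ ω, S ω ∂μ = 0) (h2 : ∫ ω, S ω ^ 2 ∂μ = V)
    (h4 : ∫ ω, S ω ^ 4 ∂μ ≤ 11 * V ^ 2) : 1 / 88 ≤ μ.real {ω | 0 ≤ S ω} := by
  -- With `t ^ 2 = 22 * V`, integrating the pointwise inequality `hpt` gives `22 V ^ 2 - 11 V ^ 2 ≤
  -- 968 V ^ 2 * P(S ≥ 0)`, which is the bound `1 / 88`.
  set t : ℝ := √(22 * V) with ht
  have ht0 : 0 < t := Real.sqrt_pos.2 (by linarith)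
  have ht2 : t ^ 2 = 22 * V := Real.sq_sqrt (by linarith)
  have hmeas : MeasurableSet {ω | 0 ≤ S ω} := measurableSet_le measurable_const hS
  have hpt : ∀ ω, t ^ 3 * S ω + t ^ 2 * S ω ^ 2 - S ω ^ 4 ≤
      Set.indicator {ω | 0 ≤ S ω} (fun _ => 2 * t ^ 4) ω := by
    intro ω
    set s := S ω
    by_cases hs : 0 ≤ s
    · rw [Set.indicator_of_mem (show ω ∈ {ω | 0 ≤ S ω} from hs)]
      nlinarith [sq_nonneg (s ^ 2 - t ^ 2), mul_nonneg (sq_nonneg t) (sq_nonneg (t - s)),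
        mul_nonneg (sq_nonneg t) (mul_nonneg ht0.le hs)]
    · rw [Set.indicator_of_notMem (show ω ∉ {ω | 0 ≤ S ω} from hs)]
      have hu : 0 < -s := by linarith [not_le.1 hs]
      have h3 : 0 ≤ t ^ 3 - t ^ 2 * (-s) + (-s) ^ 3 := by
        rcases le_total (-s) t with h | h
        · have := mul_nonneg (sq_nonneg t) (sub_nonneg.2 h)
          have := pow_pos hu 3
          nlinarith
        · have := mul_nonneg hu.le (mul_nonneg (sub_nonneg.2 h) (by linarith : 0 ≤ -s + t))
          have := pow_pos ht0 3
          nlinarith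
      nlinarith [mul_nonneg hu.le h3]
  have hint := integral_mono (((i1.const_mul (t ^ 3)).add (i2.const_mul (t ^ 2))).sub i4)
    ((integrable_const (2 * t ^ 4)).indicator hmeas) hpt
  rw [integral_indicator hmeas, setIntegral_const, smul_eq_mul] at hint
  have hl : ∫ ω, (t ^ 3 * S ω + t ^ 2 * S ω ^ 2 - S ω ^ 4) ∂μ =
      t ^ 2 * V - ∫ ω, S ω ^ 4 ∂μ := by
    rw [integral_sub ((i1.const_mul _).fun_add (i2.const_mul _)) i4,
      integral_add (i1.const_mul _) (i2.const_mul _), integral_const_mul, integral_const_mul,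
      h1, h2]
    ring
  have hint' : t ^ 2 * V - ∫ ω, S ω ^ 4 ∂μ ≤ μ.real {ω | 0 ≤ S ω} * (2 * t ^ 4) := by
    rw [← hl]; exact hint
  have ht4 : t ^ 4 = 484 * V ^ 2 := by
    calc t ^ 4 = (t ^ 2) ^ 2 := by ring
      _ = 484 * V ^ 2 := by rw [ht2]; ring
  rw [ht2, ht4] at hint'
  have h5 : 11 * V ^ 2 ≤ μ.real {ω | 0 ≤ S ω} * 968 * V ^ 2 := by nlinarith
  have h6 : 11 ≤ μ.real {ω | 0 ≤ S ω} * 968 := le_of_mul_le_mul_right h5 (by positivity)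
  linarith

/-- If `V ≤ x ^ 2 / 2`, a Chebyshev argument suffices. Otherwise `x ^ 2 < 2 * V`, so the fourth
moment is at most `11 * V ^ 2` and already `S ≥ 0` has the required probability. -/
theorem le_measureReal_neg_le_of_fourth_moment {S : Ω → ℝ} {V x : ℝ} (hS : Measurable S)
    (hV : 0 ≤ V) (hx : 0 < x) (i1 : Integrable S μ) (i2 : Integrable (fun ω => S ω ^ 2) μ)
    (i4 : Integrable (fun ω => S ω ^ 4) μ) (h1 : ∫ ω, S ω ∂μ = 0) (h2 : ∫ ω, S ω ^ 2 ∂μ = V)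
    (h4 : ∫ ω, S ω ^ 4 ∂μ ≤ 4 * x ^ 2 * V + 3 * V ^ 2) : 1 / 88 ≤ μ.real {ω | -x ≤ S ω} := by
  rcases le_or_gt V (x ^ 2 / 2) with h | h
  · have hmeas : MeasurableSet {ω | -x ≤ S ω} := measurableSet_le measurable_const hS
    have hpt : ∀ ω, x ^ 2 - S ω ^ 2 ≤ Set.indicator {ω | -x ≤ S ω} (fun _ => x ^ 2) ω := by
      intro ω
      by_cases hs : -x ≤ S ω
      · rw [Set.indicator_of_mem (show ω ∈ {ω | -x ≤ S ω} from hs)]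
        linarith [sq_nonneg (S ω)]
      · rw [Set.indicator_of_notMem (show ω ∉ {ω | -x ≤ S ω} from hs)]
        nlinarith [not_le.1 hs]
    have hint := integral_mono ((integrable_const (x ^ 2)).sub i2)
      ((integrable_const (x ^ 2)).indicator hmeas) hpt
    have hl : ∫ ω, (x ^ 2 - S ω ^ 2) ∂μ = x ^ 2 - V := by
      rw [integral_sub (integrable_const _) i2, h2]; simp
    rw [integral_indicator hmeas, setIntegral_const, smul_eq_mul] at hint
    have hint' : x ^ 2 - V ≤ μ.real {ω | -x ≤ S ω} * x ^ 2 := by rw [← hl]; exact hint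
    have h3 : 1 / 2 * x ^ 2 ≤ μ.real {ω | -x ≤ S ω} * x ^ 2 := by linarith
    have := le_of_mul_le_mul_right h3 (by positivity)
    linarith
  · have hV0 : 0 < V := lt_of_le_of_lt (by positivity) h
    refine (le_measureReal_nonneg_of_fourth_moment hS hV0 i1 i2 i4 h1 h2 ?_).trans
      (measureReal_mono fun ω (hω : 0 ≤ S ω) => ?_)
    · nlinarith
    · show -x ≤ S ω
      linarith

end Moments

section Product

variable (q : Measure ℕ) [IsProbabilityMeasure q]

theorem integrable_pi_of_abs_le {l : ℕ} {F : (Fin l → ℕ) → ℝ} {H : ℝ} (hF : ∀ ω, |F ω| ≤ H) :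
    Integrable F (Measure.pi fun _ : Fin l => q) :=
  Integrable.of_bound (measurable_of_countable F).aestronglyMeasurable H
    (Filter.Eventually.of_forall hF)

theorem integral_pi_succ {l : ℕ} {F : (Fin (l + 1) → ℕ) → ℝ} {H : ℝ} (hF : ∀ ω, |F ω| ≤ H) :
    ∫ ω, F ω ∂(Measure.pi fun _ : Fin (l + 1) => q) =
      ∫ k, ∫ ω, F (Fin.cons k ω) ∂(Measure.pi fun _ : Fin l => q) ∂q := by
  have h := measurePreserving_piFinSuccAbove (fun _ : Fin (l + 1) => q) 0
  have h1 := (h.symm _).integral_comp' F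
  rw [← h1, integral_prod]
  · have h2 : ∀ (k : ℕ) (ω : Fin l → ℕ), (MeasurableEquiv.piFinSuccAbove (fun _ => ℕ) 0).symm (k, ω) =
        (Fin.cons k ω : Fin (l + 1) → ℕ) := fun k ω => Fin.insertNth_zero' k ω
    simp only [h2]
  · exact Integrable.of_bound (measurable_of_countable _).aestronglyMeasurable H
      (Filter.Eventually.of_forall fun _ => hF _)

/-- Induction by splitting off the first coordinate: binomial terms linear in either factor vanish
by centring. In particular the third moment `m3` need not be computed. -/
theorem moments_sum_pi {X : ℕ → ℝ} {M : ℝ} (hX : ∀ k, |X k| ≤ M) (h0 : ∫ k, X k ∂q = 0) (l : ℕ) :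
    ∫ ω, ∑ i, X (ω i) ∂(Measure.pi fun _ : Fin l => q) = 0 ∧
    ∫ ω, (∑ i, X (ω i)) ^ 2 ∂(Measure.pi fun _ : Fin l => q) = l * ∫ k, X k ^ 2 ∂q ∧
    ∫ ω, (∑ i, X (ω i)) ^ 4 ∂(Measure.pi fun _ : Fin l => q) ≤
      l * ∫ k, X k ^ 4 ∂q + 3 * (l * ∫ k, X k ^ 2 ∂q) ^ 2 := by
  have hSb : ∀ (l : ℕ) (ω : Fin l → ℕ), |∑ i, X (ω i)| ≤ l * M := fun l ω =>
    (Finset.abs_sum_le_sum_abs _ _).trans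
      ((Finset.sum_le_sum fun i _ => hX (ω i)).trans (by simp))
  have hpow : ∀ (l j : ℕ) (ω : Fin l → ℕ), |(∑ i, X (ω i)) ^ j| ≤ (l * M) ^ j := fun l j ω => by
    rw [abs_pow]; exact pow_le_pow_left₀ (abs_nonneg _) (hSb l ω) j
  have hXpow : ∀ j k, |X k ^ j| ≤ M ^ j := fun j k => by
    rw [abs_pow]; exact pow_le_pow_left₀ (abs_nonneg _) (hX k) j
  have iS : ∀ j, Integrable (fun ω => (∑ i, X (ω i)) ^ j) (Measure.pi fun _ : Fin l => q) :=
    fun j => integrable_pi_of_abs_le q (hpow l j)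
  have iX : ∀ j, Integrable (fun k => X k ^ j) q := fun j =>
    Integrable.of_bound (measurable_of_countable _).aestronglyMeasurable (M ^ j)
      (Filter.Eventually.of_forall (hXpow j))
  have iX1 : Integrable X q := by simpa using iX 1
  induction l with
  | zero => simp
  | succ l ih =>
    have iS' : ∀ j, Integrable (fun ω => (∑ i, X (ω i)) ^ j) (Measure.pi fun _ : Fin l => q) :=
      fun j => integrable_pi_of_abs_le q (hpow l j)
    have iS1 : Integrable (fun ω => ∑ i, X (ω i)) (Measure.pi fun _ : Fin l => q) := by
      simpa using iS' 1
    obtain ⟨ih1, ih2, ih4⟩ := ih iS'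
    have hcons : ∀ (k : ℕ) (ω : Fin l → ℕ),
        ∑ i, X ((Fin.cons k ω : Fin (l + 1) → ℕ) i) = X k + ∑ i, X (ω i) := fun k ω => by
      simp [Fin.sum_univ_succ]
    refine ⟨?_, ?_, ?_⟩
    · rw [integral_pi_succ q (hSb (l + 1))]
      simp only [hcons]
      have : ∀ k, ∫ ω, (X k + ∑ i, X (ω i)) ∂(Measure.pi fun _ : Fin l => q) = X k := fun k => by
        rw [integral_add (integrable_const _) iS1, ih1]; simp
      simp only [this, h0]
    · rw [integral_pi_succ q (hpow (l + 1) 2)]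
      simp only [hcons]
      have : ∀ k, ∫ ω, (X k + ∑ i, X (ω i)) ^ 2 ∂(Measure.pi fun _ : Fin l => q) =
          X k ^ 2 + l * ∫ k, X k ^ 2 ∂q := fun k => by
        have he : ∀ ω : Fin l → ℕ, (X k + ∑ i, X (ω i)) ^ 2 =
            X k ^ 2 + (2 * X k * ∑ i, X (ω i) + (∑ i, X (ω i)) ^ 2) := fun ω => by ring
        simp only [he]
        rw [integral_add (integrable_const _) ((iS1.const_mul _).fun_add (iS' 2)),
          integral_add (iS1.const_mul _) (iS' 2), integral_const_mul, ih1, ih2]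
        simp
      simp only [this]
      rw [integral_add (iX 2) (integrable_const _)]
      simp
      ring
    · rw [integral_pi_succ q (hpow (l + 1) 4)]
      simp only [hcons]
      set m3 := ∫ ω, (∑ i, X (ω i)) ^ 3 ∂(Measure.pi fun _ : Fin l => q)
      set m4 := ∫ ω, (∑ i, X (ω i)) ^ 4 ∂(Measure.pi fun _ : Fin l => q)
      set v := ∫ k, X k ^ 2 ∂q with hv
      have : ∀ k, ∫ ω, (X k + ∑ i, X (ω i)) ^ 4 ∂(Measure.pi fun _ : Fin l => q) =
          X k ^ 4 + (6 * (l * v) * X k ^ 2 + (4 * m3 * X k + m4)) := fun k => by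
        have he : ∀ ω : Fin l → ℕ, (X k + ∑ i, X (ω i)) ^ 4 =
            X k ^ 4 + (4 * X k ^ 3 * ∑ i, X (ω i) + (6 * X k ^ 2 * (∑ i, X (ω i)) ^ 2 +
              (4 * X k * (∑ i, X (ω i)) ^ 3 + (∑ i, X (ω i)) ^ 4))) := fun ω => by ring
        simp only [he]
        rw [integral_add (integrable_const _) ((iS1.const_mul _).fun_add
            (((iS' 2).const_mul _).fun_add (((iS' 3).const_mul _).fun_add (iS' 4)))),
          integral_add (iS1.const_mul _)
            (((iS' 2).const_mul _).fun_add (((iS' 3).const_mul _).fun_add (iS' 4))),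
          integral_add ((iS' 2).const_mul _) (((iS' 3).const_mul _).fun_add (iS' 4)),
          integral_add ((iS' 3).const_mul _) (iS' 4), integral_const_mul, integral_const_mul,
          integral_const_mul, ih1, ih2]
        simp
        ring
      simp only [this]
      rw [integral_add (iX 4) (((iX 2).const_mul _).fun_add
          ((iX1.const_mul _).fun_add (integrable_const _))),
        integral_add ((iX 2).const_mul _) ((iX1.const_mul _).fun_add (integrable_const _)),
        integral_add (iX1.const_mul _) (integrable_const _), integral_const_mul,
        integral_const_mul, h0]
      simp only [integral_const, probReal_univ, smul_eq_mul, one_mul, mul_zero, zero_add]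
      rw [← hv]
      push_cast
      nlinarith [sq_nonneg v]

theorem le_measureReal_sum_pi {Z : ℕ → ℝ} {M x : ℝ} (hZ0 : ∀ k, 0 ≤ Z k) (hZM : ∀ k, Z k ≤ M)
    (hx : 0 < x) (hM : M ≤ 2 * x) (l : ℕ) :
    1 / 88 ≤ (Measure.pi fun _ : Fin l => q).real
      {ω | l * ∫ k, Z k ∂q - x ≤ ∑ i, Z (ω i)} := by
  have hM0 : 0 ≤ M := (hZ0 0).trans (hZM 0)
  have iZ : Integrable Z q := Integrable.of_bound (measurable_of_countable _).aestronglyMeasurable M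
    (Filter.Eventually.of_forall fun k => by
      rw [Real.norm_of_nonneg (hZ0 k)]; exact hZM k)
  set m : ℝ := ∫ k, Z k ∂q with hm
  have hm0 : 0 ≤ m := integral_nonneg hZ0
  have hmM : m ≤ M := by
    have := integral_mono iZ (integrable_const M) hZM
    simpa using this
  set X : ℕ → ℝ := fun k => Z k - m with hXdef
  have hX : ∀ k, |X k| ≤ M := fun k => by
    rw [abs_le]
    constructor <;> simp only [hXdef] <;> linarith [hZ0 k, hZM k]
  have h0 : ∫ k, X k ∂q = 0 := by
    simp only [hXdef]
    rw [integral_sub iZ (integrable_const _)]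
    simp [← hm]
  obtain ⟨h1, h2, h4⟩ := moments_sum_pi q hX h0 l
  have hSb : ∀ (j : ℕ) (ω : Fin l → ℕ), |(∑ i, X (ω i)) ^ j| ≤ (l * M) ^ j := fun j ω => by
    rw [abs_pow]
    exact pow_le_pow_left₀ (abs_nonneg _) ((Finset.abs_sum_le_sum_abs _ _).trans
      ((Finset.sum_le_sum fun i _ => hX (ω i)).trans (by simp))) j
  have iS : ∀ j, Integrable (fun ω => (∑ i, X (ω i)) ^ j) (Measure.pi fun _ : Fin l => q) :=
    fun j => integrable_pi_of_abs_le q (hSb j)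
  have hv0 : 0 ≤ ∫ k, X k ^ 2 ∂q := integral_nonneg fun k => sq_nonneg _
  have iX : ∀ j, Integrable (fun k => X k ^ j) q := fun j =>
    Integrable.of_bound (measurable_of_countable _).aestronglyMeasurable (M ^ j)
      (Filter.Eventually.of_forall fun k => by
        rw [norm_pow]; exact pow_le_pow_left₀ (norm_nonneg _) (hX k) j)
  -- This is where truncation at a level comparable to `x` enters: `|X| ≤ 2 * x`.
  have hX4 : ∫ k, X k ^ 4 ∂q ≤ 4 * x ^ 2 * ∫ k, X k ^ 2 ∂q := by
    rw [← integral_const_mul]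
    refine integral_mono (iX 4) ((iX 2).const_mul _) fun k => ?_
    have h5 : X k ^ 2 ≤ (2 * x) ^ 2 := by
      rw [← sq_abs (X k)]
      exact pow_le_pow_left₀ (abs_nonneg _) ((hX k).trans hM) 2
    show X k ^ 4 ≤ 4 * x ^ 2 * X k ^ 2
    nlinarith [mul_le_mul_of_nonneg_right h5 (sq_nonneg (X k))]
  have hfour : ∫ ω, (∑ i, X (ω i)) ^ 4 ∂(Measure.pi fun _ : Fin l => q) ≤
      4 * x ^ 2 * (l * ∫ k, X k ^ 2 ∂q) + 3 * (l * ∫ k, X k ^ 2 ∂q) ^ 2 := by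
    refine h4.trans ?_
    have := mul_le_mul_of_nonneg_left hX4 (Nat.cast_nonneg (α := ℝ) l)
    linarith
  have key := le_measureReal_neg_le_of_fourth_moment (measurable_of_countable _) (by positivity) hx
    (by simpa using iS 1) (iS 2) (iS 4) h1 h2 hfour
  refine key.trans (measureReal_mono fun ω hω => ?_)
  have h6 : ∑ i, X (ω i) = ∑ i, Z (ω i) - l * m := by
    simp [hXdef, Finset.sum_sub_distrib]
  have h7 : -x ≤ ∑ i, X (ω i) := hω
  show l * m - x ≤ ∑ i, Z (ω i)
  linarith

/-- **One big jump**: a sum of `l + 1` independent copies of `Y` is large with probability at least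
of the order of `(l + 1) P(B ≤ Y)`. -/
theorem le_measureReal_sum_pi_of_jump {Y Z : ℕ → ℝ} {M x B : ℝ} (hZ0 : ∀ k, 0 ≤ Z k)
    (hZM : ∀ k, Z k ≤ M) (hZY : ∀ k, Z k ≤ Y k) (hx : 0 < x) (hM : M ≤ 2 * x) (l : ℕ)
    (hl : l * q.real {k | B ≤ Y k} ≤ 1 / 176) :
    ((l : ℝ) + 1) * q.real {k | B ≤ Y k} / 176 ≤ (Measure.pi fun _ : Fin (l + 1) => q).real
      {ω | B + (l * ∫ k, Z k ∂q - x) ≤ ∑ i, Y (ω i)} := by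
  set G : Set ℕ := {k | B ≤ Y k} with hG
  set s : ℝ := l * ∫ k, Z k ∂q - x with hs
  -- Good behaviour of the other coordinates, with no jump among them. Excluding jumps costs at most
  -- `1 / 176` of the `1 / 88`, and makes the events `E i` below disjoint since the jumping index is
  -- unique.
  set R : Set (Fin l → ℕ) := {ω | s ≤ ∑ i, Z (ω i)} \ ⋃ j, {ω | ω j ∈ G} with hR
  have hRm : 1 / 176 ≤ (Measure.pi fun _ : Fin l => q).real R := by
    have h1 := le_measureReal_sum_pi q hZ0 hZM hx hM l
    have h2 : (Measure.pi fun _ : Fin l => q).real (⋃ j : Fin l, {ω | ω j ∈ G}) ≤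
        l * q.real G := by
      refine (measureReal_iUnion_fintype_le _).trans ?_
      have h3 : ∀ j : Fin l, (Measure.pi fun _ : Fin l => q).real {ω | ω j ∈ G} = q.real G :=
        fun j => (measurePreserving_eval (fun _ : Fin l => q) j).measureReal_preimage
          (MeasurableSet.of_discrete).nullMeasurableSet
      simp [h3]
    have h4 := le_measureReal_sdiff (μ := Measure.pi fun _ : Fin l => q)
      (s₁ := {ω | s ≤ ∑ i, Z (ω i)}) (s₂ := ⋃ j : Fin l, {ω | ω j ∈ G})
    linarith
  let E : Fin (l + 1) → Set (Fin (l + 1) → ℕ) := fun i =>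
    (MeasurableEquiv.piFinSuccAbove (fun _ => ℕ) i) ⁻¹' (G ×ˢ R)
  have hE : ∀ i, (Measure.pi fun _ : Fin (l + 1) => q).real (E i) =
      q.real G * (Measure.pi fun _ : Fin l => q).real R := fun i => by
    have h := (measurePreserving_piFinSuccAbove (fun _ : Fin (l + 1) => q) i).measureReal_preimage
      (s := G ×ˢ R) (MeasurableSet.of_discrete).nullMeasurableSet
    exact h.trans (measureReal_prod_prod _ _)
  have hdisj : Pairwise (Function.onFun Disjoint E) := by
    intro i j hij
    refine Set.disjoint_left.2 fun ω hi hj => ?_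
    obtain ⟨k, hk⟩ := Fin.exists_succAbove_eq hij
    have h1 : ω i ∈ G := hi.1
    refine hj.2.2 (Set.mem_iUnion.2 ⟨k, ?_⟩)
    change ω (j.succAbove k) ∈ G
    rw [hk]; exact h1
  have hsub : (⋃ i, E i) ⊆ {ω | B + s ≤ ∑ i, Y (ω i)} := by
    refine Set.iUnion_subset fun i ω hω => ?_
    have h1 : B ≤ Y (ω i) := hω.1
    have h2 : s ≤ ∑ k, Z (ω (i.succAbove k)) := hω.2.1
    have h3 : ∑ k, Z (ω (i.succAbove k)) ≤ ∑ k, Y (ω (i.succAbove k)) :=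
      Finset.sum_le_sum fun k _ => hZY _
    show B + s ≤ ∑ i, Y (ω i)
    rw [Fin.sum_univ_succAbove _ i]
    linarith
  refine le_trans ?_ (measureReal_mono hsub)
  rw [measureReal_iUnion_fintype hdisj fun i => MeasurableSet.of_discrete]
  simp only [hE, Finset.sum_const, Finset.card_univ, Fintype.card_fin, nsmul_eq_mul]
  push_cast
  have : q.real G * (1 / 176) ≤ q.real G * (Measure.pi fun _ : Fin l => q).real R :=
    mul_le_mul_of_nonneg_left hRm measureReal_nonneg
  calc ((l : ℝ) + 1) * q.real G / 176 = ((l : ℝ) + 1) * (q.real G * (1 / 176)) := by ring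
    _ ≤ _ := by gcongr

end Product

/-! ### Excursions of a renewal chain -/

/-- The probability that `m` plus `L` independent excursion lengths is at least `n`. -/
noncomputable def excursionProb (p : ℝ) (n L m : ℕ) : ENNReal :=
  (Measure.pi fun _ : Fin L => renewalKernel p 0) {ω | n ≤ m + ∑ i, (ω i + 1)}

theorem measure_eq_tsum_inter_fiber {Ω : Type*} [MeasurableSpace Ω] (P : Measure Ω) {Y : Ω → ℕ}
    (hY : Measurable Y) {S : Set Ω} (hS : MeasurableSet S) :
    P S = ∑' k, P (S ∩ {ω | Y ω = k}) := by
  have hk : ∀ k, MeasurableSet {ω | Y ω = k} := fun k => hY (measurableSet_singleton k)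
  rw [← measure_iUnion _ fun k => hS.inter (hk k)]
  · congr 1
    ext ω
    simp
  · intro i j hij
    refine Set.disjoint_left.2 fun ω hi hj => hij ?_
    exact hi.2.symm.trans hj.2

section Excursion

variable {p : ℝ}

theorem excursionProb_zero_left (hp : 1 < p) (L m : ℕ) : excursionProb p 0 L m = 1 := by
  have := isMarkovKernel_renewalKernel hp
  simp [excursionProb]

theorem excursionProb_succ_zero_zero (n : ℕ) : excursionProb p (n + 1) 0 0 = 0 := by
  simp [excursionProb]

theorem excursionProb_succ_succ (n L m : ℕ) :
    excursionProb p (n + 1) L (m + 1) = excursionProb p n L m := by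
  simp only [excursionProb]
  congr 1
  ext ω
  simp only [Set.mem_ofPred_eq]
  omega

theorem excursionProb_mono (n L : ℕ) : Monotone (excursionProb p n L) := fun m m' h =>
  measure_mono fun ω (hω : n ≤ m + _) => show n ≤ m' + _ by omega

theorem excursionProb_step (hp : 1 < p) (n L : ℕ) :
    excursionProb p (n + 1) (L + 1) 0 =
      ∑' k, renewalKernel p 0 {k} * excursionProb p n L k := by
  have := isMarkovKernel_renewalKernel hp
  have h := measurePreserving_piFinSuccAbove (fun _ : Fin (L + 1) => renewalKernel p 0) 0
  let S : Set (ℕ × (Fin L → ℕ)) := {y | n ≤ y.1 + ∑ i, (y.2 i + 1)}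
  have h1 : excursionProb p (n + 1) (L + 1) 0 =
      ((renewalKernel p 0).prod (Measure.pi fun _ : Fin L => renewalKernel p 0)) S := by
    rw [← h.measure_preimage (MeasurableSet.of_discrete).nullMeasurableSet, excursionProb]
    congr 1
    ext ω
    have h2 : (MeasurableEquiv.piFinSuccAbove (fun _ => ℕ) 0) ω = (ω 0, Fin.tail ω) := rfl
    simp only [Set.mem_ofPred_eq, Set.mem_preimage, h2, S, Fin.sum_univ_succ, Fin.tail]
    omega
  rw [h1, Measure.prod_apply (MeasurableSet.of_discrete), lintegral_countable']
  exact tsum_congr fun k => mul_comm _ _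

/-! ### Visits to 0 and the Markov property along paths -/

variable {Ω : Type*} {Y : ℕ → Ω → ℕ}

/-- The number of visits to `0` during `[j, j + n)`. -/
def visits (Y : ℕ → Ω → ℕ) (j n : ℕ) (ω : Ω) : ℕ :=
  ∑ i ∈ Finset.range n, if Y (j + i) ω = 0 then 1 else 0

theorem visits_succ (Y : ℕ → Ω → ℕ) (j n : ℕ) (ω : Ω) :
    visits Y j (n + 1) ω = (if Y j ω = 0 then 1 else 0) + visits Y (j + 1) n ω := by
  rw [visits, Finset.sum_range_succ', add_comm]
  simp only [visits, add_zero]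
  congr 1
  exact Finset.sum_congr rfl fun i _ => by rw [add_right_comm, add_assoc]

/-- The event that the chain follows the path `a` up to time `j`. -/
def pathEvent (Y : ℕ → Ω → ℕ) (a : ℕ → ℕ) (j : ℕ) : Set Ω := {ω | ∀ i ≤ j, Y i ω = a i}

theorem pathEvent_inter_eq (a : ℕ → ℕ) (j k : ℕ) :
    pathEvent Y a j ∩ {ω | Y (j + 1) ω = k} =
      pathEvent Y (Function.update a (j + 1) k) (j + 1) := by
  ext ω
  simp only [pathEvent, Set.mem_inter_iff, Set.mem_ofPred_eq]
  constructor
  · rintro ⟨h1, h2⟩ i hi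
    rcases Nat.lt_or_ge j i with h | h
    · obtain rfl : i = j + 1 := by omega
      simpa using h2
    · rw [Function.update_of_ne (by omega)]
      exact h1 i h
  · intro h
    refine ⟨fun i hi => ?_, by simpa using h (j + 1) le_rfl⟩
    have := h i (by omega)
    rwa [Function.update_of_ne (by omega)] at this

variable [MeasurableSpace Ω] {P : Measure Ω}

theorem measurable_visits (hY : ∀ i, Measurable (Y i)) (j n : ℕ) : Measurable (visits Y j n) := by
  refine Finset.measurable_fun_sum _ fun i _ => ?_
  exact (measurable_of_countable fun y : ℕ => if y = 0 then 1 else 0).comp (hY _)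

theorem measurableSet_pathEvent (hY : ∀ i, Measurable (Y i)) (a : ℕ → ℕ) (j : ℕ) :
    MeasurableSet (pathEvent Y a j) := by
  have : pathEvent Y a j = ⋂ i, ⋂ (_ : i ≤ j), {ω | Y i ω = a i} := by
    ext ω; simp [pathEvent]
  rw [this]
  exact MeasurableSet.iInter fun i => MeasurableSet.iInter fun _ =>
    hY i (measurableSet_singleton (a i))

theorem measure_pathEvent_succ {π : Measure ℕ} (hY : IsMarkovChain (renewalKernel p) π P Y)
    (a : ℕ → ℕ) (j k : ℕ) : P (pathEvent Y (Function.update a (j + 1) k) (j + 1)) =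
      P (pathEvent Y a j) * renewalKernel p (a j) {k} := by
  have h1 := hY.cylinder (j + 1) (Function.update a (j + 1) k)
  have h2 := hY.cylinder j a
  simp only [pathEvent]
  rw [h1, h2, Finset.prod_range_succ, Function.update_self, Function.update_of_ne (by omega),
    Function.update_of_ne (by omega), ← mul_assoc]
  congr 2
  refine Finset.prod_congr rfl fun i hi => ?_
  have := Finset.mem_range.1 hi
  rw [Function.update_of_ne (by omega), Function.update_of_ne (by omega)]

/-- By the Markov property, `visits ≤ L` given the past has the law of an excursion sum. -/
theorem measure_pathEvent_inter_visits_le (hp : 1 < p) {π : Measure ℕ}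
    (hY : IsMarkovChain (renewalKernel p) π P Y) (n : ℕ) : ∀ (L j : ℕ) (a : ℕ → ℕ),
      P (pathEvent Y a j ∩ {ω | visits Y j n ω ≤ L}) =
        P (pathEvent Y a j) * excursionProb p n L (a j) := by
  induction n with
  | zero =>
    intro L j a
    rw [excursionProb_zero_left hp, mul_one]
    congr 1
    ext ω
    simp [visits]
  | succ n ih =>
    have hstep : ∀ (L j : ℕ) (a : ℕ → ℕ),
        P (pathEvent Y a j ∩ {ω | visits Y (j + 1) n ω ≤ L}) =
          P (pathEvent Y a j) * ∑' k, renewalKernel p (a j) {k} * excursionProb p n L k := by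
      intro L j a
      have hm : MeasurableSet (pathEvent Y a j ∩ {ω | visits Y (j + 1) n ω ≤ L}) :=
        (measurableSet_pathEvent hY.measurable a j).inter
          (measurableSet_le (measurable_visits hY.measurable _ _) measurable_const)
      rw [measure_eq_tsum_inter_fiber P (hY.measurable (j + 1)) hm, ← ENNReal.tsum_mul_left]
      refine tsum_congr fun k => ?_
      rw [Set.inter_right_comm, pathEvent_inter_eq, ih, measure_pathEvent_succ hY,
        Function.update_self, mul_assoc]
    intro L j a
    -- At 0 the current visit uses up one unit of `L`, which is impossible when `L = 0`, and a new
    -- excursion starts. At `m + 1` the chain merely descends by one.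
    rcases ha : a j with _ | m
    · rcases L with _ | L
      · rw [excursionProb_succ_zero_zero, mul_zero]
        convert measure_empty (μ := P)
        refine Set.eq_empty_iff_forall_notMem.2 fun ω ⟨h1, h2⟩ => ?_
        have h3 : Y j ω = 0 := (h1 j le_rfl).trans ha
        have h4 : visits Y j (n + 1) ω ≤ 0 := h2
        rw [visits_succ, if_pos h3] at h4
        omega
      · rw [excursionProb_step hp, ← ha, ← hstep]
        congr 1
        ext ω
        refine and_congr_right fun h1 => ?_
        have h3 : Y j ω = 0 := (h1 j le_rfl).trans ha
        simp only [Set.mem_ofPred_eq, visits_succ, if_pos h3]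
        omega
    · have h5 : ∑' k, renewalKernel p (a j) {k} * excursionProb p n L k =
          excursionProb p n L m := by
        rw [ha, tsum_eq_single m, renewalKernel_succ]
        · simp
        · intro k hk
          rw [renewalKernel_succ]
          simp [hk.symm]
      rw [excursionProb_succ_succ, ← h5, ← hstep]
      congr 1
      ext ω
      refine and_congr_right fun h1 => ?_
      have h3 : Y j ω ≠ 0 := by rw [h1 j le_rfl, ha]; omega
      simp only [Set.mem_ofPred_eq, visits_succ, if_neg h3, zero_add]

/-- Average over the initial state: a positive start only delays the visits, so each conditional
probability is at least the one from 0. -/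
theorem excursionProb_le_measure_visits_le (hp : 1 < p) {π : Measure ℕ} [IsProbabilityMeasure π]
    (hY : IsMarkovChain (renewalKernel p) π P Y) (n L : ℕ) :
    excursionProb p n L 0 ≤ P {ω | visits Y 0 n ω ≤ L} := by
  have hm : MeasurableSet {ω | visits Y 0 n ω ≤ L} :=
    measurableSet_le (measurable_visits hY.measurable _ _) measurable_const
  have h1 : ∀ k, P ({ω | visits Y 0 n ω ≤ L} ∩ {ω | Y 0 ω = k}) =
      π {k} * excursionProb p n L k := fun k => by
    have h2 : {ω | Y 0 ω = k} = pathEvent Y (fun _ => k) 0 := by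
      ext ω; simp [pathEvent]
    have h3 := hY.cylinder 0 (fun _ => k)
    rw [Set.inter_comm, h2, measure_pathEvent_inter_visits_le hp hY]
    congr 1
    rw [← h2]
    simpa using h3
  have h4 : ∑' k, π {k} = 1 := by
    have := lintegral_countable' (μ := π) fun _ => 1
    simpa using this.symm
  rw [measure_eq_tsum_inter_fiber P (hY.measurable 0) hm, tsum_congr h1]
  calc excursionProb p n L 0 = ∑' k, π {k} * excursionProb p n L 0 := by
        rw [ENNReal.tsum_mul_right, h4, one_mul]
    _ ≤ _ := ENNReal.tsum_le_tsum fun k => by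
        gcongr
        exact excursionProb_mono n L (Nat.zero_le k)

end Excursion

/-! ### The lower bound for large deviations -/

section LowerBound

variable {p : ℝ}

theorem renewalKernel_zero_real_ge (hp : 1 < p) (B : ℕ) :
    (renewalKernel p 0).real {k | B ≤ k} = renewalTail p B := by
  have := isMarkovKernel_renewalKernel hp
  induction B with
  | zero => simp [renewalTail_zero hp]
  | succ B ih =>
    have h1 : {k | B ≤ k} = {B} ∪ {k | B + 1 ≤ k} := by
      ext k
      simp only [Set.mem_ofPred_eq, Set.mem_union, Set.mem_singleton_iff]
      omega
    have h2 : Disjoint ({B} : Set ℕ) {k | B + 1 ≤ k} := by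
      rw [Set.disjoint_singleton_left]
      simp
    have h3 : (renewalKernel p 0).real {B} = renewalProb p 0 B := by
      rw [measureReal_def, renewalKernel_singleton,
        ENNReal.toReal_ofReal (renewalProb_zero_nonneg hp B)]
    rw [h1, measureReal_union h2 MeasurableSet.of_discrete, h3, renewalTail_eq_add hp] at ih
    linarith

/-- The mean excursion length truncated at `M`. -/
theorem integral_truncated_excursion (hp : 1 < p) (M : ℕ) :
    ∫ k, min ((k : ℝ) + 1) M ∂(renewalKernel p 0) = ∑ i ∈ Finset.range M, renewalTail p i := by
  have := isMarkovKernel_renewalKernel hp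
  induction M with
  | zero =>
    have : ∀ k : ℕ, min ((k : ℝ) + 1) ((0 : ℕ) : ℝ) = 0 := fun k => by
      rw [Nat.cast_zero]; exact min_eq_right (by positivity)
    simp only [this, integral_zero, Finset.range_zero, Finset.sum_empty]
  | succ M ih =>
    -- Layer-cake decomposition: raising the cap by one adds the indicator of `M ≤ k`.
    have h1 : ∀ k : ℕ, min ((k : ℝ) + 1) ((M + 1 : ℕ) : ℝ) =
        min ((k : ℝ) + 1) M + Set.indicator {k : ℕ | M ≤ k} (fun _ => (1 : ℝ)) k := fun k => by
      by_cases h : M ≤ k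
      · have h' : (M : ℝ) ≤ k := by exact_mod_cast h
        rw [Set.indicator_of_mem (show k ∈ {k : ℕ | M ≤ k} from h),
          min_eq_right (by push_cast; linarith), min_eq_right (by linarith)]
        push_cast; ring
      · have h' : (k : ℝ) + 1 ≤ M := by exact_mod_cast not_le.1 h
        rw [Set.indicator_of_notMem (show k ∉ {k : ℕ | M ≤ k} from h),
          min_eq_left (by push_cast; linarith), min_eq_left h', add_zero]
    simp only [h1]
    rw [integral_add, ih, integral_indicator MeasurableSet.of_discrete, setIntegral_const,
      renewalKernel_zero_real_ge hp, Finset.sum_range_succ]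
    · simp
    · refine integrable_of_abs_le (H := M) fun k => ?_
      rw [abs_of_nonneg (by positivity)]
      exact min_le_right _ _
    · exact (integrable_const _).indicator MeasurableSet.of_discrete

theorem sum_renewalObservable (hp : 1 < p) {Ω : Type*} (Y : ℕ → Ω → ℕ) (n : ℕ) (ω : Ω) :
    ∑ i ∈ Finset.range n, renewalObservable p (Y i ω) = n / renewalMean p - visits Y 0 n ω := by
  simp only [renewalObservable, visits, Finset.sum_sub_distrib, Finset.sum_const,
    Finset.card_range, nsmul_eq_mul, zero_add, renewalMeasure_real_singleton hp,
    renewalTail_zero hp]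
  push_cast
  ring

/-- An excursion-sum lower bound, with the smallness requirements on `x` spelled out. -/
theorem le_excursionProb (hp : 1 < p) {C' : ℝ}
    (hC' : ∀ n : ℕ, ∑' j, renewalTail p (n + j) ≤ C' / ((n : ℝ) + 1) ^ (p - 1))
    {n l B : ℕ} {x : ℝ} (hx : 1 ≤ x) (hC'x : l * (C' / x ^ (p - 1)) ≤ x) (hC'0 : 0 ≤ C')
    (hB : l * renewalTail p B ≤ 1 / 176)
    (hn : (n : ℝ) ≤ B + 1 + (l * renewalMean p - 2 * x)) :
    ((l : ℝ) + 1) * renewalTail p B / 176 ≤ (excursionProb p n (l + 1) 0).toReal := by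
  have := isMarkovKernel_renewalKernel hp
  have hx0 : 0 < x := by linarith
  -- Truncation level. It lowers the mean by at most `C' / x ^ (p - 1)`, so `l` terms lose at most
  -- `x`; fluctuations account for the other `x` in the hypothesis on `n`.
  set M : ℕ := ⌈x⌉₊ with hM
  have hMx : x ≤ M := Nat.le_ceil x
  have hM2 : (M : ℝ) ≤ 2 * x := by
    have := (Nat.ceil_lt_add_one hx0.le).le
    linarith
  have hG : {k : ℕ | ((B : ℝ) + 1) ≤ (k : ℝ) + 1} = {k | B ≤ k} := by
    ext k
    simp
  have hmean : renewalMean p - C' / x ^ (p - 1) ≤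
      ∫ k, min ((k : ℝ) + 1) M ∂(renewalKernel p 0) := by
    rw [integral_truncated_excursion hp]
    have h1 := (summable_renewalTail hp).sum_add_tsum_nat_add M
    have h2 := hC' M
    simp only [add_comm M] at h2
    have h3 : C' / ((M : ℝ) + 1) ^ (p - 1) ≤ C' / x ^ (p - 1) := by
      gcongr
      linarith
    rw [renewalMean]
    linarith
  have key := le_measureReal_sum_pi_of_jump (renewalKernel p 0) (Y := fun k => (k : ℝ) + 1)
    (Z := fun k => min ((k : ℝ) + 1) M) (M := M) (B := (B : ℝ) + 1)
    (fun k => by positivity) (fun k => min_le_right _ _) (fun k => min_le_left _ _) hx0 hM2 l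
    (by rw [hG, renewalKernel_zero_real_ge hp]; exact hB)
  rw [hG, renewalKernel_zero_real_ge hp] at key
  refine key.trans (measureReal_mono fun ω hω => ?_)
  have h1 : (B : ℝ) + 1 + (l * ∫ k, min ((k : ℝ) + 1) M ∂(renewalKernel p 0) - x) ≤
      ∑ i, ((ω i : ℝ) + 1) := hω
  have h2 := mul_le_mul_of_nonneg_left hmean (Nat.cast_nonneg (α := ℝ) l)
  have h3 : (n : ℝ) ≤ ∑ i, ((ω i : ℝ) + 1) := by linarith
  show n ≤ 0 + ∑ i, (ω i + 1)
  rw [zero_add]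
  exact_mod_cast h3

theorem exists_le_excursionProb (hp : 1 < p) :
    ∃ κ : ℝ, 0 < κ ∧ ∀ n : ℕ, 1 ≤ n → ∀ x : ℝ, κ * (n : ℝ) ^ (1 / p) ≤ x → x ≤ κ⁻¹ * n →
      ∃ L : ℕ, (L : ℝ) ≤ n / renewalMean p - x ∧
        κ⁻¹ * (n / x ^ p) ≤ (excursionProb p n L 0).toReal := by
  obtain ⟨C, hC0, hC⟩ := exists_renewalTail_le hp
  obtain ⟨C', hC'0, hC'⟩ := exists_tsum_renewalTail_le hp
  obtain ⟨c, hc0, hc⟩ := exists_le_renewalTail hp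
  set μ : ℝ := renewalMean p with hμdef
  have hμ1 : 1 ≤ μ := one_le_renewalMean hp
  have hμ0 : 0 < μ := by linarith
  set A : ℝ := 352 * μ * (3 * μ + 4) ^ p / c with hA
  have hA0 : 0 < A := by positivity
  -- Each summand serves one requirement: `1` gives `x ≥ 1`, `C'` the truncation loss, `176 * C` the
  -- rarity of a second jump, `4 * μ` the bound `L ≥ n / (2 * μ)`, and `A` the final constant.
  set κ : ℝ := 1 + C' + 176 * C + 4 * μ + A with hκ
  have hκ1 : 1 ≤ κ := by linarith
  have hκ0 : 0 < κ := by linarith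
  refine ⟨κ, hκ0, fun n hn x hx1 hx2 => ?_⟩
  have hn1 : (1 : ℝ) ≤ n := by exact_mod_cast hn
  have hn0 : (0 : ℝ) < n := by linarith
  have hroot : 1 ≤ (n : ℝ) ^ (1 / p) := Real.one_le_rpow hn1 (by positivity)
  have hκx : κ ≤ x := by nlinarith
  have hx : 1 ≤ x := hκ1.trans hκx
  have hx0 : 0 < x := by linarith
  have hxn : x * κ ≤ n := by
    rw [inv_mul_eq_div, le_div_iff₀ hκ0] at hx2
    exact hx2
  have hxp : κ * n ≤ x ^ p := by
    calc κ * n ≤ κ ^ p * n := by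
          gcongr
          exact Real.self_le_rpow_of_one_le hκ1 hp.le
      _ = (κ * (n : ℝ) ^ (1 / p)) ^ p := by
          rw [Real.mul_rpow hκ0.le (by positivity), ← Real.rpow_mul hn0.le,
            one_div_mul_cancel (by linarith), Real.rpow_one]
      _ ≤ x ^ p := Real.rpow_le_rpow (by positivity) hx1 (by linarith)
  have hxp0 : 0 < x ^ p := Real.rpow_pos_of_pos hx0 p
  have hκn : κ ≤ n := by nlinarith
  have hfloor0 : 0 ≤ n / μ - x := by
    rw [sub_nonneg, le_div_iff₀ hμ0]
    nlinarith
  set L : ℕ := ⌊n / μ - x⌋₊ with hL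
  have hL1 : (L : ℝ) ≤ n / μ - x := Nat.floor_le hfloor0
  have hL2 : n / μ - x < L + 1 := Nat.lt_floor_add_one _
  have hL3 : n / (2 * μ) ≤ L := by
    have h1 : x + 1 ≤ n / (2 * μ) := by
      rw [le_div_iff₀ (by positivity)]
      nlinarith
    have h2 : n / μ = n / (2 * μ) + n / (2 * μ) := by field_simp; ring
    linarith
  have hLpos : 0 < L := by
    have : (0 : ℝ) < L := lt_of_lt_of_le (by positivity) hL3
    exact_mod_cast this
  obtain ⟨l, hl⟩ : ∃ l, L = l + 1 := ⟨L - 1, by omega⟩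
  refine ⟨L, hL1, ?_⟩
  have hlL : (L : ℝ) = l + 1 := by rw [hl]; push_cast; ring
  have hln : (l : ℝ) ≤ n := by
    have : n / μ ≤ n := div_le_self hn0.le hμ1
    linarith
  -- Rounding `L` and taking `l = L - 1` leave a gap `n - l * μ ≤ μ * (x + 2) ≤ 3 * μ * x`; the
  -- extra `2 * x` covers the deficit of the other excursions.
  set B : ℕ := ⌈(3 * μ + 2) * x⌉₊ with hB
  have hB1 : (3 * μ + 2) * x ≤ B := Nat.le_ceil _
  have hB2 : (B : ℝ) < (3 * μ + 2) * x + 1 := Nat.ceil_lt_add_one (by positivity)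
  have hBx : x ≤ (B : ℝ) + 1 := by nlinarith
  have hB3 : (B : ℝ) + 1 ≤ (3 * μ + 4) * x := by nlinarith
  have hmain := le_excursionProb hp hC' (n := n) (l := l) (B := B) hx ?_ hC'0.le ?_ ?_
  · rw [hl]
    refine le_trans ?_ hmain
    rw [← hlL]
    have h1 : c / ((3 * μ + 4) * x) ^ p ≤ renewalTail p B := by
      refine le_trans ?_ (hc B)
      gcongr
    have h2 : κ⁻¹ ≤ A⁻¹ := inv_anti₀ hA0 (by linarith)
    calc κ⁻¹ * (n / x ^ p) ≤ A⁻¹ * (n / x ^ p) := by gcongr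
      _ = n / (2 * μ) * (c / ((3 * μ + 4) * x) ^ p) / 176 := by
          rw [hA, Real.mul_rpow (by positivity) hx0.le]
          have := (Real.rpow_pos_of_pos (show 0 < 3 * μ + 4 by positivity) p).ne'
          field_simp
          norm_num
      _ ≤ L * renewalTail p B / 176 := by gcongr
  · rw [Real.rpow_sub_one hx0.ne']
    have h1 : l * (C' / (x ^ p / x)) = x * (l * C' / x ^ p) := by field_simp
    rw [h1]
    refine mul_le_of_le_one_right hx0.le ?_
    rw [div_le_one hxp0]
    calc l * C' ≤ n * κ := by
          refine mul_le_mul hln ?_ hC'0.le hn0.le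
          linarith
      _ ≤ x ^ p := by linarith
  · calc l * renewalTail p B ≤ n * (C / ((B : ℝ) + 1) ^ p) :=
          mul_le_mul hln (hC B) (renewalTail_nonneg hp B) hn0.le
      _ ≤ n * (C / x ^ p) := by gcongr
      _ ≤ 1 / 176 := by
          rw [mul_div_assoc', div_le_div_iff₀ hxp0 (by norm_num)]
          have : n * (176 * C) ≤ n * κ := by
            refine mul_le_mul_of_nonneg_left ?_ hn0.le
            linarith
          linarith
  · have h1 : (n : ℝ) ≤ μ * (l + 2 + x) := by
      have : n / μ ≤ l + 2 + x := by linarith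
      rw [div_le_iff₀ hμ0] at this
      linarith
    have h2 : μ ≤ μ * x := le_mul_of_one_le_right hμ0.le hx
    linarith

end LowerBound

theorem proposition4p1 (p : ℝ) (hp : 1 < p) :
    IsMarkovKernel (renewalKernel p) ∧
    IsProbabilityMeasure (renewalMeasure p) ∧
    (renewalKernel p).Invariant (renewalMeasure p) ∧
    ConditionH (renewalKernel p) (renewalMeasure p) (boundedFunctions ℕ) supNorm p ∧
    ∫ m, renewalObservable p m ∂(renewalMeasure p) = 0 ∧
    ∃ κ : ℝ, 0 < κ ∧
      ∀ (Ω : Type*) [MeasurableSpace Ω] (P : Measure Ω) [IsProbabilityMeasure P]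
        (Y : ℕ → Ω → ℕ), IsMarkovChain (renewalKernel p) (renewalMeasure p) P Y →
      ∀ n : ℕ, 1 ≤ n →
      ∀ x : ℝ, κ * (n : ℝ) ^ (1 / p) ≤ x → x ≤ κ⁻¹ * (n : ℝ) →
        κ⁻¹ * ((n : ℝ) / x ^ p) ≤
          P.real {ω | x ≤ ∑ i ∈ Finset.range n, renewalObservable p (Y i ω)} := by
  refine ⟨isMarkovKernel_renewalKernel hp, isProbabilityMeasure_renewalMeasure hp,
    renewalMeasure_invariant hp, conditionH_renewalKernel hp, integral_renewalObservable hp, ?_⟩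
  obtain ⟨κ, hκ, h⟩ := exists_le_excursionProb hp
  refine ⟨κ, hκ, fun Ω _ P _ Y hY n hn x hx1 hx2 => ?_⟩
  have := isProbabilityMeasure_renewalMeasure hp
  obtain ⟨L, hL, hle⟩ := h n hn x hx1 hx2
  refine hle.trans ?_
  refine (ENNReal.toReal_mono (measure_ne_top _ _)
    (excursionProb_le_measure_visits_le hp hY n L)).trans
      (measureReal_mono fun ω (hω : visits Y 0 n ω ≤ L) => ?_)
  show x ≤ ∑ i ∈ Finset.range n, renewalObservable p (Y i ω)
  rw [sum_renewalObservable hp]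
  have : (visits Y 0 n ω : ℝ) ≤ L := by exact_mod_cast hω
  linarith
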